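/- Let $M$ be a compact connected smooth manifold without boundary, and let $h_1,h_2$ be smooth Riemannian metrics on $M$ with $h_2=\nu^2h_1$ for a nonconstant function $\nu:M\to(0,\infty)$. For a metric $h$, let $W(M,h)$ be the set of Borel probability measures on $M$ with finite second moment for the Riemannian distance of $h$; for $\mu\in W(M,h)$ let $L^2(TM,h,\mu)$ be the space of measurable vector fields $v$ with $\int_M h(v,v)\,d\mu<\infty$, modulo $\mu$-almost everywhere equality, with inner product $\int_M h(v,w)\,d\mu$, and let $$T_\mu W(M,h)=\overline{\{\nabla^{h}\varphi \mid \varphi\in C_c^\infty(M)\}}^{\,L^2(TM,h,\mu)} .$$ For a smooth map $f$ and $F=f_\#$ (push-forward of measures), let $dF_\mu(v)$ be the fibre-averaged vector field $$dF_\mu(v)_y=\int_{f^{-1}(y)}df_x(v_x)\,d\mu^y(x),$$ where $(\mu^y)_y$ is the disintegration of $\mu$ along $f$ (and $dF_\mu(v)_y=0$ for $y\notin f(M)$). Let $f=\mathrm{id}_M$, $F=\mathrm{id}_\#:W(M,h_1)\to W(M,h_2)$, and let $\mu=\mu_{h_1}/\mu_{h_1}(M)$ be the normalized Riemannian volume measure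 of $h_1$. Then $\mu\in W(M,h_1)$, and there is a smooth function $\varphi$ on $M$ with $\nabla^{h_1}\varphi\in T_\mu W(M,h_1)$ such that $dF_\mu(\nabla^{h_1}\varphi)$ defines an element of $L^2(TM,h_2,F(\mu))$ and $$dF_\mu(\nabla^{h_1}\varphi)\notin T_{F(\mu)}W(M,h_2).$$ -/

import Mathlib

open MeasureTheory Manifold Bundle ProbabilityTheory Set
open scoped ContDiff ENNReal Topology

namespace WassersteinTangent

set_option linter.unusedSectionVars false

noncomputable section

/-- Smooth Riemannian metrics on the smooth `n`-manifold `M` (without boundary). -/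
abbrev SmoothMetric (n : ℕ) (M : Type*) [TopologicalSpace M] [ChartedSpace (EuclideanSpace ℝ (Fin n)) M]
    [IsManifold (𝓡 n) ∞ M] : Type _ :=
  ContMDiffRiemannianMetric (𝓡 n) ∞ (EuclideanSpace ℝ (Fin n)) (fun x : M => TangentSpace (𝓡 n) x)

/-- Not necessarily continuous vector fields on `M`. -/
abbrev VField (n : ℕ) (M : Type*) [TopologicalSpace M]
    [ChartedSpace (EuclideanSpace ℝ (Fin n)) M] : Type _ :=
  (x : M) → TangentSpace (𝓡 n) x

section
variable {n : ℕ} {M : Type*} [TopologicalSpace M] [ChartedSpace (EuclideanSpace ℝ (Fin n)) M]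
  [IsManifold (𝓡 n) ∞ M]

theorem exists_gradient (h : SmoothMetric n M) (φ : M → ℝ) (x : M) :
    ∃ v : TangentSpace (𝓡 n) x, ∀ w : TangentSpace (𝓡 n) x,
      h.inner x v w = (show ℝ from mfderiv (𝓡 n) 𝓘(ℝ, ℝ) φ x w) := by
  let B : EuclideanSpace ℝ (Fin n) →ₗ[ℝ] Module.Dual ℝ (EuclideanSpace ℝ (Fin n)) :=
    { toFun := fun v => (h.inner x v).toLinearMap
      map_add' := fun v w => by ext u; exact congrArg (fun f => f u) ((h.inner x).map_add v w)
      map_smul' := fun c v => by ext u; exact congrArg (fun f => f u) ((h.inner x).map_smul c v) }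
  have hB : Function.Injective B := by
    rw [injective_iff_map_eq_zero]
    intro v hv
    by_contra hne
    have h1 := h.pos x v hne
    have h2 : h.inner x v v = 0 := congrArg (fun f => f v) hv
    exact h1.ne' h2
  have hs : Function.Surjective B :=
    (LinearMap.injective_iff_surjective_of_finrank_eq_finrank
      (Subspace.dual_finrank_eq (K := ℝ) (V := EuclideanSpace ℝ (Fin n))).symm).1 hB
  obtain ⟨v, hv⟩ := hs ((mfderiv (𝓡 n) 𝓘(ℝ, ℝ) φ x).toLinearMap)
  exact ⟨v, fun w => congrArg (fun f => f w) hv⟩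

/-- The gradient of `φ` with respect to `h`: `h (∇φ, w) = dφ (w)` for all tangent vectors `w`. -/
def gradient (h : SmoothMetric n M) (φ : M → ℝ) : VField n M :=
  fun x => (exists_gradient h φ x).choose

theorem inner_gradient (h : SmoothMetric n M) (φ : M → ℝ) (x : M) (w : TangentSpace (𝓡 n) x) :
    h.inner x (gradient h φ x) w = (show ℝ from mfderiv (𝓡 n) 𝓘(ℝ, ℝ) φ x w) :=
  (exists_gradient h φ x).choose_spec w

theorem normSq_nonneg (h : SmoothMetric n M) (x : M) (v : TangentSpace (𝓡 n) x) :
    0 ≤ h.inner x v v := by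
  by_cases hv : v = 0
  · subst hv; simp
  · exact (h.pos x v hv).le

theorem two_mul_abs_inner_le (h : SmoothMetric n M) (x : M) (v w : TangentSpace (𝓡 n) x) :
    2 * |h.inner x v w| ≤ h.inner x v v + h.inner x w w := by
  have h1 := normSq_nonneg h x (v + w)
  have h2 := normSq_nonneg h x (v - w)
  simp only [map_add, map_sub, _root_.add_apply, _root_.sub_apply,
    h.symm x w v] at h1 h2
  rcases abs_cases (h.inner x v w) with ⟨h3, _⟩ | ⟨h3, _⟩ <;> rw [h3] <;> linarith

theorem continuous_normSq (h : SmoothMetric n M) :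
    Continuous (fun p : TangentBundle (𝓡 n) M => h.inner p.1 p.2 p.2) := by
  let : RiemannianBundle (fun x : M => TangentSpace (𝓡 n) x) := ⟨h.toRiemannianMetric⟩
  have : IsContinuousRiemannianBundle (EuclideanSpace ℝ (Fin n))
      (fun x : M => TangentSpace (𝓡 n) x) :=
    ⟨h.inner, h.contMDiff.continuous, fun _ _ _ => rfl⟩
  exact Continuous.inner_bundle (F := EuclideanSpace ℝ (Fin n))
    (E := fun x : M => TangentSpace (𝓡 n) x)
    (b := fun p : TangentBundle (𝓡 n) M => p.1) (v := fun p => p.2) (w := fun p => p.2)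
    continuous_id continuous_id

/-- The Riemannian distance of `h`, the infimum of the `h`-lengths of `C^1` paths. -/
def riemannianDist (h : SmoothMetric n M) (x y : M) : ℝ≥0∞ :=
  letI : RiemannianBundle (fun x : M => TangentSpace (𝓡 n) x) := ⟨h.toRiemannianMetric⟩
  riemannianEDist (𝓡 n) x y

theorem riemannianDist_triangle (h : SmoothMetric n M) (x y z : M) :
    riemannianDist h x z ≤ riemannianDist h x y + riemannianDist h y z := by
  let : RiemannianBundle (fun x : M => TangentSpace (𝓡 n) x) := ⟨h.toRiemannianMetric⟩
  exact riemannianEDist_triangle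

theorem riemannianDist_comm (h : SmoothMetric n M) (x y : M) :
    riemannianDist h x y = riemannianDist h y x := by
  let : RiemannianBundle (fun x : M => TangentSpace (𝓡 n) x) := ⟨h.toRiemannianMetric⟩
  exact riemannianEDist_comm

theorem eventually_riemannianDist_lt_one (h : SmoothMetric n M) (x : M) :
    ∀ᶠ y in 𝓝 x, riemannianDist h x y < 1 := by
  let : RiemannianBundle (fun x : M => TangentSpace (𝓡 n) x) := ⟨h.toRiemannianMetric⟩
  have : IsManifold (𝓡 n) 1 M := .of_le (n := ∞) (by norm_cast)
  have : IsContinuousRiemannianBundle (EuclideanSpace ℝ (Fin n))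
      (fun x : M => TangentSpace (𝓡 n) x) :=
    ⟨h.inner, h.contMDiff.continuous, fun _ _ _ => rfl⟩
  exact eventually_riemannianEDist_lt (𝓡 n) x one_pos

theorem riemannianDist_bounded [CompactSpace M] [ConnectedSpace M] (h : SmoothMetric n M) (x : M) :
    ∃ C : ℝ≥0∞, C ≠ ⊤ ∧ ∀ y, riemannianDist h x y ≤ C := by
  have key : ∀ y : M, riemannianDist h x y < ⊤ := by
    have hcl : IsClopen {y : M | riemannianDist h x y < ⊤} := by
      constructor
      · rw [← isOpen_compl_iff, isOpen_iff_mem_nhds]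
        intro y hy
        filter_upwards [eventually_riemannianDist_lt_one h y] with z hz hz'
        apply hy
        refine (riemannianDist_triangle h x z y).trans_lt (ENNReal.add_lt_top.2 ⟨hz', ?_⟩)
        rw [riemannianDist_comm]
        exact hz.trans ENNReal.one_lt_top
      · rw [isOpen_iff_mem_nhds]
        intro y hy
        filter_upwards [eventually_riemannianDist_lt_one h y] with z hz
        exact (riemannianDist_triangle h x y z).trans_lt
          (ENNReal.add_lt_top.2 ⟨hy, hz.trans ENNReal.one_lt_top⟩)
    have hne : {y : M | riemannianDist h x y < ⊤}.Nonempty :=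
      ⟨x, ((eventually_riemannianDist_lt_one h x).self_of_nhds).trans ENNReal.one_lt_top⟩
    intro y
    have hy : y ∈ {y : M | riemannianDist h x y < ⊤} := hcl.eq_univ hne ▸ mem_univ y
    exact hy
  obtain ⟨t, ht⟩ := isCompact_univ.elim_nhds_subcover
    (fun z : M => {y | riemannianDist h z y < 1})
    (fun z _ => eventually_riemannianDist_lt_one h z)
  refine ⟨∑ z ∈ t, (riemannianDist h x z + 1), ?_, fun y => ?_⟩
  · exact (ENNReal.sum_lt_top.2 fun z _ => ENNReal.add_lt_top.2 ⟨key z, ENNReal.one_lt_top⟩).ne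
  · have := ht.2 (mem_univ y)
    simp only [mem_iUnion, exists_prop] at this
    obtain ⟨z, hz, hzy⟩ := this
    calc riemannianDist h x y ≤ riemannianDist h x z + riemannianDist h z y :=
          riemannianDist_triangle h x z y
      _ ≤ riemannianDist h x z + 1 := by gcongr; exact le_of_lt hzy
      _ ≤ _ := Finset.single_le_sum (f := fun z => riemannianDist h x z + 1)
          (fun _ _ => zero_le) hz

end

section
variable {n : ℕ} {M : Type*} [TopologicalSpace M] [ChartedSpace (EuclideanSpace ℝ (Fin n)) M]
  [IsManifold (𝓡 n) ∞ M] [MeasurableSpace M] [BorelSpace M] 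

/-- Borel measurable sections of the tangent bundle. -/
def IsMeasurableField (v : VField n M) : Prop :=
  @Measurable M (TangentBundle (𝓡 n) M) _ (borel _) (fun x => ⟨x, v x⟩)

theorem IsMeasurableField.normSq {v : VField n M} (hv : IsMeasurableField v) (h : SmoothMetric n M) :
    Measurable (fun x => h.inner x (v x) (v x)) := by
  let : MeasurableSpace (TangentBundle (𝓡 n) M) := borel _
  have : BorelSpace (TangentBundle (𝓡 n) M) := ⟨rfl⟩
  exact (continuous_normSq h).measurable.comp hv

theorem IsMeasurableField.zero : IsMeasurableField (0 : VField n M) := by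
  let : MeasurableSpace (TangentBundle (𝓡 n) M) := borel _
  have : BorelSpace (TangentBundle (𝓡 n) M) := ⟨rfl⟩
  exact (contMDiff_zeroSection ℝ (fun x : M => TangentSpace (𝓡 n) x) (IB := 𝓡 n) (n := ∞)).continuous.measurable

theorem isMeasurableField_of_coords [SecondCountableTopology M] {v : VField n M}
    (hv : ∀ x₀ : M, Measurable (fun x =>
      (trivializationAt (EuclideanSpace ℝ (Fin n))
          (fun x : M => TangentSpace (𝓡 n) x) x₀).baseSet.indicator
        (fun x => (trivializationAt (EuclideanSpace ℝ (Fin n))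
          (fun x : M => TangentSpace (𝓡 n) x) x₀ ⟨x, v x⟩).2) x)) :
    IsMeasurableField v := by
  let : MeasurableSpace (TangentBundle (𝓡 n) M) := borel _
  have : BorelSpace (TangentBundle (𝓡 n) M) := ⟨rfl⟩
  unfold IsMeasurableField
  refine measurable_of_isOpen fun s hs => ?_
  obtain ⟨t, htc, ht⟩ := TopologicalSpace.countable_cover_nhds (α := M)
    (f := fun x₀ => (trivializationAt (EuclideanSpace ℝ (Fin n))
          (fun x : M => TangentSpace (𝓡 n) x) x₀).baseSet)
    (fun x₀ => (trivializationAt _ _ x₀).open_baseSet.mem_nhds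
      (FiberBundle.mem_baseSet_trivializationAt' x₀))
  have : (fun x => (⟨x, v x⟩ : TangentBundle (𝓡 n) M)) ⁻¹' s = ⋃ x₀ ∈ t,
      ((fun x => (⟨x, v x⟩ : TangentBundle (𝓡 n) M)) ⁻¹' s ∩
        (trivializationAt (EuclideanSpace ℝ (Fin n))
          (fun x : M => TangentSpace (𝓡 n) x) x₀).baseSet) := by
    rw [← inter_iUnion₂, ht, inter_univ]
  rw [this]
  refine MeasurableSet.biUnion htc fun x₀ _ => ?_
  set e := trivializationAt (EuclideanSpace ℝ (Fin n)) (fun x : M => TangentSpace (𝓡 n) x) x₀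
    with he
  have hm : Measurable (fun x => (x, e.baseSet.indicator (fun x => (e ⟨x, v x⟩).2) x)) :=
    measurable_id.prodMk (hv x₀)
  have hopen : IsOpen (e.toOpenPartialHomeomorph '' (e.source ∩ s)) :=
    e.toOpenPartialHomeomorph.isOpen_image_source_inter hs
  have : (fun x => (⟨x, v x⟩ : TangentBundle (𝓡 n) M)) ⁻¹' s ∩ e.baseSet =
      (fun x => (x, e.baseSet.indicator (fun x => (e ⟨x, v x⟩).2) x)) ⁻¹'
        (e.toOpenPartialHomeomorph '' (e.source ∩ s)) ∩ e.baseSet := by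
    ext x
    simp only [mem_inter_iff, mem_preimage, and_congr_left_iff]
    intro hx
    rw [indicator_of_mem hx]
    have hsrc : (⟨x, v x⟩ : TangentBundle (𝓡 n) M) ∈ e.source := e.mem_source.2 hx
    have hex : (x, (e ⟨x, v x⟩).2) = e ⟨x, v x⟩ := Prod.ext (e.coe_fst hsrc).symm rfl
    rw [hex]
    constructor
    · intro hxs
      exact ⟨_, ⟨hsrc, hxs⟩, rfl⟩
    · rintro ⟨p, ⟨hp, hps⟩, hpe⟩
      have := e.toOpenPartialHomeomorph.injOn hp hsrc hpe
      rwa [← this]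
  rw [this]
  exact (hm hopen.measurableSet).inter e.open_baseSet.measurableSet

theorem IsMeasurableField.coords {v : VField n M} (hv : IsMeasurableField v) (x₀ : M) :
    Measurable (fun x =>
      (trivializationAt (EuclideanSpace ℝ (Fin n))
          (fun x : M => TangentSpace (𝓡 n) x) x₀).baseSet.indicator
        (fun x => (trivializationAt (EuclideanSpace ℝ (Fin n))
          (fun x : M => TangentSpace (𝓡 n) x) x₀ ⟨x, v x⟩).2) x) := by
  let : MeasurableSpace (TangentBundle (𝓡 n) M) := borel _
  have : BorelSpace (TangentBundle (𝓡 n) M) := ⟨rfl⟩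
  set e := trivializationAt (EuclideanSpace ℝ (Fin n)) (fun x : M => TangentSpace (𝓡 n) x) x₀
    with he
  have hU : MeasurableSet e.baseSet := e.open_baseSet.measurableSet
  have h1 : Measurable (fun p : TangentBundle (𝓡 n) M =>
      e.source.indicator (fun p => (e p).2) p) := by
    refine measurable_of_isOpen fun s hs => ?_
    have hA : MeasurableSet (e.source ∩ (fun p => (e p).2) ⁻¹' s) :=
      ((continuous_snd.comp_continuousOn e.continuousOn).isOpen_inter_preimage
        e.open_source hs).measurableSet
    have hB : (fun p : TangentBundle (𝓡 n) M => e.source.indicator (fun p => (e p).2) p) ⁻¹' s =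
        (e.source ∩ (fun p => (e p).2) ⁻¹' s) ∪
          (e.sourceᶜ ∩ {_p | (0 : EuclideanSpace ℝ (Fin n)) ∈ s}) := by
      ext p
      by_cases hp : p ∈ e.source
      · simp [hp]
      · simp [hp]
    rw [hB]
    exact hA.union (e.open_source.measurableSet.compl.inter (MeasurableSet.const _))
  have h2 := h1.comp hv
  convert h2 using 1
  ext1 x
  by_cases hx : x ∈ e.baseSet
  · have hsrc : (⟨x, v x⟩ : TangentBundle (𝓡 n) M) ∈ e.source := e.mem_source.2 hx
    simp [indicator_of_mem hx, indicator_of_mem hsrc]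
  · have hsrc : (⟨x, v x⟩ : TangentBundle (𝓡 n) M) ∉ e.source := fun h' => hx (e.mem_source.1 h')
    simp [indicator_of_notMem hx, indicator_of_notMem hsrc]


theorem IsMeasurableField.add [SecondCountableTopology M] {v w : VField n M}
    (hv : IsMeasurableField v) (hw : IsMeasurableField w) : IsMeasurableField (v + w) := by
  refine isMeasurableField_of_coords fun x₀ => ?_
  convert! (hv.coords x₀).add (hw.coords x₀) using 1
  ext1 x
  by_cases hx : x ∈ (trivializationAt (EuclideanSpace ℝ (Fin n))
      (fun x : M => TangentSpace (𝓡 n) x) x₀).baseSet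
  · simp only [Pi.add_apply, indicator_of_mem hx]
    exact ((trivializationAt (EuclideanSpace ℝ (Fin n))
      (fun x : M => TangentSpace (𝓡 n) x) x₀).linear ℝ hx).map_add (v x) (w x)
  · simp only [Pi.add_apply, indicator_of_notMem hx, add_zero]

theorem IsMeasurableField.smul [SecondCountableTopology M] (c : ℝ) {v : VField n M}
    (hv : IsMeasurableField v) : IsMeasurableField (c • v) := by
  refine isMeasurableField_of_coords fun x₀ => ?_
  convert! (hv.coords x₀).const_smul c using 1
  ext1 x
  by_cases hx : x ∈ (trivializationAt (EuclideanSpace ℝ (Fin n))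
      (fun x : M => TangentSpace (𝓡 n) x) x₀).baseSet
  · simp only [Pi.smul_apply, indicator_of_mem hx]
    exact ((trivializationAt (EuclideanSpace ℝ (Fin n))
      (fun x : M => TangentSpace (𝓡 n) x) x₀).linear ℝ hx).map_smul c (v x)
  · simp only [Pi.smul_apply, indicator_of_notMem hx, smul_zero]

theorem IsMeasurableField.inner [SecondCountableTopology M] {v w : VField n M}
    (hv : IsMeasurableField v) (hw : IsMeasurableField w) (h : SmoothMetric n M) :
    Measurable (fun x => h.inner x (v x) (w x)) := by
  have h1 := ((hv.add hw).normSq h).sub ((hv.normSq h).add (hw.normSq h))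
  convert! h1.const_mul (1 / 2 : ℝ) using 1
  ext1 x
  simp only [Pi.add_apply, map_add, _root_.add_apply, Pi.sub_apply]
  rw [h.symm x (w x) (v x)]
  ring

variable [SecondCountableTopology M]

/-- Measurable vector fields `v` with `∫ h(v,v) dμ < ∞`. -/
def sqIntegrableFields (h : SmoothMetric n M) (μ : Measure M) : Submodule ℝ (VField n M) where
  carrier := {v | IsMeasurableField v ∧ Integrable (fun x => h.inner x (v x) (v x)) μ}
  zero_mem' := ⟨IsMeasurableField.zero, by simp⟩
  add_mem' := by
    rintro v w ⟨hv, hv'⟩ ⟨hw, hw'⟩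
    refine ⟨hv.add hw, Integrable.mono' ((hv'.add hw').const_mul 2)
      ((hv.add hw).normSq h).aestronglyMeasurable (ae_of_all _ fun x => ?_)⟩
    rw [Real.norm_of_nonneg (normSq_nonneg h x _)]
    have h2 := normSq_nonneg h x (v x - w x)
    simp only [Pi.add_apply, map_add, map_sub, _root_.add_apply,
      _root_.sub_apply] at h2 ⊢
    linarith
  smul_mem' := by
    rintro c v ⟨hv, hv'⟩
    refine ⟨hv.smul c, (hv'.const_mul (c * c)).congr (ae_of_all _ fun x => ?_)⟩
    simp [mul_assoc]

/-- The space of square integrable vector fields, before identifying fields that agree almost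
everywhere. It carries the semi-inner product `∫ h(v,w) dμ` (see `L2Field.core`). -/
def L2Field (h : SmoothMetric n M) (μ : Measure M) : Type _ := sqIntegrableFields h μ

instance (h : SmoothMetric n M) (μ : Measure M) : AddCommGroup (L2Field h μ) :=
  inferInstanceAs (AddCommGroup (sqIntegrableFields h μ))

instance (h : SmoothMetric n M) (μ : Measure M) : Module ℝ (L2Field h μ) :=
  inferInstanceAs (Module ℝ (sqIntegrableFields h μ))

/-- The vector field underlying an element of `L2Field h μ`. -/
def L2Field.toField {h : SmoothMetric n M} {μ : Measure M} (v : L2Field h μ) : VField n M :=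
  (sqIntegrableFields h μ).subtype v

theorem integrable_inner {h : SmoothMetric n M} {μ : Measure M} (v w : L2Field h μ) :
    Integrable (fun x => h.inner x (v.toField x) (w.toField x)) μ := by
  refine Integrable.mono' (v.2.2.add w.2.2) (v.2.1.inner w.2.1 h).aestronglyMeasurable
    (ae_of_all _ fun x => ?_)
  have h1 := two_mul_abs_inner_le h x (v.toField x) (w.toField x)
  have h2 := abs_nonneg (h.inner x (v.toField x) (w.toField x))
  rw [Real.norm_eq_abs]
  exact le_trans (by linarith) h1

/-- The semi-inner product `⟨v,w⟩ = ∫ h(v,w) dμ`. -/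
instance L2Field.core (h : SmoothMetric n M) (μ : Measure M) :
    PreInnerProductSpace.Core ℝ (L2Field h μ) where
  inner v w := ∫ x, h.inner x (v.toField x) (w.toField x) ∂μ
  conj_inner_symm v w := by
    simp only [conj_trivial]
    exact integral_congr_ae (ae_of_all _ fun x => h.symm x _ _)
  re_inner_nonneg v := integral_nonneg fun x => normSq_nonneg h x _
  add_left u v w := by
    rw [← integral_add (integrable_inner u w) (integrable_inner v w)]
    refine integral_congr_ae (ae_of_all _ fun x => ?_)
    change h.inner x (u.toField x + v.toField x) _ = _
    simp
  smul_left u v c := by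
    simp only [conj_trivial]
    rw [← integral_const_mul]
    refine integral_congr_ae (ae_of_all _ fun x => ?_)
    change h.inner x (c • u.toField x) _ = _
    simp

instance (h : SmoothMetric n M) (μ : Measure M) : SeminormedAddCommGroup (L2Field h μ) :=
  InnerProductSpace.Core.toSeminormedAddCommGroup (𝕜 := ℝ)

instance (h : SmoothMetric n M) (μ : Measure M) : InnerProductSpace ℝ (L2Field h μ) :=
  InnerProductSpace.ofCore (L2Field.core h μ)

/-- The inner product space `L²(TM, μ)` of square integrable vector fields modulo the fields of
seminorm zero, that is (see `L2.mk_eq_mk_iff`) modulo almost everywhere equality. -/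
abbrev L2 (h : SmoothMetric n M) (μ : Measure M) : Type _ := SeparationQuotient (L2Field h μ)


theorem L2.mk_eq_mk_iff {h : SmoothMetric n M} {μ : Measure M} (v w : L2Field h μ) :
    (SeparationQuotient.mk v : L2 h μ) = SeparationQuotient.mk w ↔
      v.toField =ᵐ[μ] w.toField := by
  rw [SeparationQuotient.mk_eq_mk, Metric.inseparable_iff, dist_eq_norm]
  change √(∫ x, h.inner x ((v - w).toField x) ((v - w).toField x) ∂μ) = 0 ↔ _
  rw [Real.sqrt_eq_zero (integral_nonneg fun x => normSq_nonneg h x _),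
    integral_eq_zero_iff_of_nonneg (fun x => normSq_nonneg h x _) (integrable_inner _ _)]
  refine Filter.eventually_congr (ae_of_all _ fun x => ?_)
  change h.inner x (v.toField x - w.toField x) (v.toField x - w.toField x) = 0 ↔ _
  constructor
  · intro h0
    by_contra hne
    exact (h.pos x _ (sub_ne_zero.2 hne)).ne' h0
  · intro h0
    rw [h0]
    simp

/-- The class in `L²(TM, μ)` of the vector field `v` is (defined and equal to) `V`. -/
def IsClassOf {h : SmoothMetric n M} {μ : Measure M} (V : L2 h μ) (v : VField n M) : Prop :=
  ∃ u : L2Field h μ, u.toField =ᵐ[μ] v ∧ SeparationQuotient.mk u = V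

end

/-! ### The Riemannian volume measure -/

section
variable {n : ℕ} {M : Type*} [TopologicalSpace M] [ChartedSpace (EuclideanSpace ℝ (Fin n)) M]
  [IsManifold (𝓡 n) ∞ M]

/-- The matrix `(h_ij)` of the metric in the coordinates of the chart `e`, at the point of
coordinates `y`. -/
def chartGram (h : SmoothMetric n M) (e : OpenPartialHomeomorph M (EuclideanSpace ℝ (Fin n)))
    (y : EuclideanSpace ℝ (Fin n)) : Matrix (Fin n) (Fin n) ℝ :=
  Matrix.of fun i j => h.inner (e.symm y)
    (mfderiv (𝓡 n) (𝓡 n) e.symm y (EuclideanSpace.single i (1 : ℝ)))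
    (mfderiv (𝓡 n) (𝓡 n) e.symm y (EuclideanSpace.single j (1 : ℝ)))

variable [MeasurableSpace M]

/-- The Riemannian volume in the domain of the chart `e`: the image under the inverse of `e` of
`√(det h_ij) dy` on the target of `e`. -/
def chartVolume (h : SmoothMetric n M)
    (e : OpenPartialHomeomorph M (EuclideanSpace ℝ (Fin n))) : Measure M :=
  (((volume : Measure (EuclideanSpace ℝ (Fin n))).restrict e.target).withDensity
    (fun y => ENNReal.ofReal √(chartGram h e y).det)).map e.symm

theorem exists_seq_chart_cover (n : ℕ) (M : Type*) [TopologicalSpace M]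
    [ChartedSpace (EuclideanSpace ℝ (Fin n)) M] [SecondCountableTopology M] [Nonempty M] :
    ∃ p : ℕ → M, ⋃ k, (chartAt (EuclideanSpace ℝ (Fin n)) (p k)).source = univ := by
  obtain ⟨s, hsc, hs⟩ := TopologicalSpace.countable_cover_nhds (α := M)
    (f := fun x => (chartAt (EuclideanSpace ℝ (Fin n)) x).source)
    (fun x => chart_source_mem_nhds _ x)
  have hne : s.Nonempty := by
    by_contra hcon
    rw [not_nonempty_iff_eq_empty] at hcon
    subst hcon
    simp only [mem_empty_iff_false, iUnion_of_empty, iUnion_empty] at hs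
    exact empty_ne_univ hs
  obtain ⟨p, rfl⟩ := hsc.exists_eq_range hne
  exact ⟨p, by simpa using hs⟩

/-- A sequence of points whose preferred charts cover `M`. -/
def coverPoint (n : ℕ) (M : Type*) [TopologicalSpace M]
    [ChartedSpace (EuclideanSpace ℝ (Fin n)) M] [SecondCountableTopology M] [Nonempty M] :
    ℕ → M :=
  (exists_seq_chart_cover n M).choose

/-- The Riemannian volume measure `μ_h`. The manifold is cut into countably many disjoint Borel
pieces, each in the domain of a chart, and the volume of a piece is computed in that chart. By the
change of variables formula the result does not depend on the charts or the pieces. -/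
def riemannianVolume [SecondCountableTopology M] [Nonempty M] (h : SmoothMetric n M) :
    Measure M :=
  Measure.sum fun k : ℕ =>
    (chartVolume h (chartAt (EuclideanSpace ℝ (Fin n)) (coverPoint n M k))).restrict
      (disjointed
        (fun k => (chartAt (EuclideanSpace ℝ (Fin n)) (coverPoint n M k)).source) k)

end

/-! ### Wasserstein spaces and their tangent spaces -/

section
variable {n : ℕ} {M : Type*} [TopologicalSpace M] [ChartedSpace (EuclideanSpace ℝ (Fin n)) M]
  [IsManifold (𝓡 n) ∞ M] [MeasurableSpace M] [BorelSpace M]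
variable {m : ℕ} {N : Type*} [TopologicalSpace N] [ChartedSpace (EuclideanSpace ℝ (Fin m)) N]
  [IsManifold (𝓡 m) ∞ N] [MeasurableSpace N] [BorelSpace N]

/-- The set of points of the Wasserstein space `W(M, h) = W₂(M, h)`: Borel probability measures
with finite second moment for the Riemannian distance. -/
def WassersteinSpace (h : SmoothMetric n M) : Type _ :=
  {μ : Measure M // IsProbabilityMeasure μ ∧ ∃ x₀, ∫⁻ x, riemannianDist h x₀ x ^ 2 ∂μ < ⊤}

/-- The measure underlying a point of the Wasserstein space. -/
def WassersteinSpace.measure {h : SmoothMetric n M} (μ : WassersteinSpace h) : Measure M :=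
  μ.1

instance {h : SmoothMetric n M} (μ : WassersteinSpace h) : IsProbabilityMeasure μ.measure :=
  μ.2.1

/-- The tangent space `T_μ W(M, h)`: the closure in `L²(TM, μ)` of the set of gradients of
compactly supported smooth functions. -/
def WassersteinSpace.tangentSpace [SecondCountableTopology M] {h : SmoothMetric n M}
    (μ : WassersteinSpace h) : Set (L2 h μ.measure) :=
  closure {V | ∃ φ : M → ℝ, ContMDiff (𝓡 n) 𝓘(ℝ, ℝ) ∞ φ ∧ HasCompactSupport φ ∧
    IsClassOf V (gradient h φ)}

/-- The map `F = f_#` between Wasserstein spaces, for a compact connected target manifold (on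
which every probability measure has finite second moment). -/
def pushforward (h : SmoothMetric n M) (g : SmoothMetric m N) [CompactSpace N] [ConnectedSpace N]
    (f : M → N) (hf : Measurable f) (μ : WassersteinSpace h) : WassersteinSpace g :=
  ⟨μ.measure.map f, Measure.isProbabilityMeasure_map hf.aemeasurable, by
    have : IsProbabilityMeasure (μ.measure.map f) :=
      Measure.isProbabilityMeasure_map hf.aemeasurable
    obtain ⟨y⟩ : Nonempty N := inferInstance
    obtain ⟨C, hC, hy⟩ := riemannianDist_bounded g y
    refine ⟨y, ?_⟩
    calc ∫⁻ x, riemannianDist g y x ^ 2 ∂(μ.measure.map f)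
        ≤ ∫⁻ _, C ^ 2 ∂(μ.measure.map f) := lintegral_mono fun x => by gcongr; exact hy x
      _ = C ^ 2 := by simp
      _ < ⊤ := (ENNReal.pow_ne_top hC).lt_top⟩

instance (priority := 50) polishSpace_of_compactSpace {X : Type*} [TopologicalSpace X] [T2Space X]
    [CompactSpace X] [SecondCountableTopology X] : PolishSpace X := by
  let _ := TopologicalSpace.metrizableSpaceMetric X
  infer_instance

/-- The fibre-averaged field `y ↦ ∫_{f⁻¹(y)} df_x(v_x) dμ^y(x)`, where `(μ^y)` is the
disintegration of `μ` along `f`, that is the regular conditional distribution under `μ` of the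
point `x` given `f x`. For `y` outside the range of `f` the value is `0`. -/
def fibreAverage [StandardBorelSpace M] [Nonempty M] (f : M → N) (μ : Measure M)
    [IsFiniteMeasure μ] (v : VField n M) : VField m N :=
  fun y => show EuclideanSpace ℝ (Fin m) from
    ∫ x in f ⁻¹' {y}, (show EuclideanSpace ℝ (Fin m) from mfderiv (𝓡 n) (𝓡 m) f x (v x))
      ∂(condDistrib id f μ y)

/-- `dF_μ(V) = W`, where `F = f_#`: the class of the fibre-averaged field of (a representative of)
`V` in `L²(TN, F(μ))` is defined and equal to `W`. -/
def IsDifferentialAt [StandardBorelSpace M] [Nonempty M] [SecondCountableTopology M]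
    [SecondCountableTopology N] [CompactSpace N] [ConnectedSpace N]
    {h : SmoothMetric n M} (g : SmoothMetric m N) (f : M → N) (hf : Measurable f)
    (μ : WassersteinSpace h) (V : L2 h μ.measure) (W : L2 g (pushforward h g f hf μ).measure) :
    Prop :=
  ∃ v : L2Field h μ.measure, SeparationQuotient.mk v = V ∧
    IsClassOf W (fibreAverage f μ.measure v.toField)

end
end
end WassersteinTangent

/-!
Write `u = ν ^ 2`. The `h₂`-dual covector of `∇^{h₁} φ - ∇^{h₂} ψ` is `u dφ - dψ`
(`inner_gradient_sub_gradient`), and the differential of `id_#` is the identity on fields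
(`fibreAverage_id`). So the claim is that for some `φ` the covector field `u dφ` is not a limit in
the mean square of exact covector fields `dψ`. In a chart `√(det h_ij)` is bounded below on compact
sets and the Riemannian volume may be computed in any chart (`restrict_riemannianVolume`), so such a
limit would also hold in the mean for the Lebesgue measure of the chart
(`tendsto_setLIntegral_enorm_sub`).

Since `u` is smooth and not constant, `du ≠ 0` at some point
(`exists_fderiv_conformalFactor_sq_ne_zero`), and `φ` is a bump function near this point.

In dimension at least two `u dφ` is not even a limit of closed covector fields: its differential is
`du ∧ dφ`, and the integral of the wedge product of `u dφ` with a cut off second coordinate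
differential is, up to sign, the integral of a partial derivative of `u` against `φ`
(`false_of_tendsto_of_ne`).

In dimension one every covector field is closed and the obstruction is global. If `dψ` is close to
`u dφ` in the mean, then the increment of `ψ` across the support of `φ` is close to the integral of
`u dφ`, which is minus that of `φ du` and does not vanish. But `dψ` is close to `0` off the support
of `φ`, and the complement of an arc in a closed connected one-dimensional manifold is connected
(`isPreconnected_compl_arc`), so the increment of `ψ` between the two ends of the arc is also close
to `0` (`tendsto_sub_of_isPreconnected`). The connectedness is proved without classifying
one-dimensional manifolds: a maximal proper connected open subset is the complement of a point
(`exists_isPreconnected_compl_singleton`), and whether the complement of a point is connected does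
not depend on the point.
-/

namespace WassersteinTangent

set_option linter.unusedSectionVars false

/-! ### Connectedness of the complement of an arc in a closed one-dimensional manifold -/

/-- A nontrivial compact connected locally connected space has a point whose complement is
connected. A maximal proper connected open subset is the complement of such a point: the union with
a small connected neighbourhood of a boundary point must be the whole space. -/
theorem exists_isPreconnected_compl_singleton {X : Type*} [TopologicalSpace X] [T1Space X]
    [CompactSpace X] [ConnectedSpace X] [LocallyConnectedSpace X] [Nontrivial X] :
    ∃ p : X, IsPreconnected ({p}ᶜ : Set X) := by
  have nbhd : ∀ (a : X) (U : Set X), IsOpen U → a ∈ U →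
      ∃ V ⊆ U, IsOpen V ∧ IsPreconnected V ∧ a ∈ V := by
    intro a U hU ha
    exact ⟨connectedComponentIn U a, connectedComponentIn_subset U a, hU.connectedComponentIn,
      isPreconnected_connectedComponentIn, mem_connectedComponentIn ha⟩
  obtain ⟨a, b, hab⟩ := exists_pair_ne X
  obtain ⟨V₀, hV₀, hV₀o, hV₀c, haV₀⟩ := nbhd a {b}ᶜ isOpen_compl_singleton hab
  let S : Set (Set X) := {V | IsOpen V ∧ IsPreconnected V ∧ V ≠ univ}
  have hS : V₀ ∈ S := ⟨hV₀o, hV₀c, fun h => hV₀ (h ▸ mem_univ b) rfl⟩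
  obtain ⟨V, hV₀V, hV⟩ := zorn_subset_nonempty S (by
    intro c hc hchain hne
    refine ⟨⋃₀ c, ⟨isOpen_sUnion fun s hs => (hc hs).1,
      IsPreconnected.sUnion_directed hchain.directedOn fun s hs => (hc hs).2.1, ?_⟩,
      fun s hs => subset_sUnion_of_mem hs⟩
    intro hu
    rw [sUnion_eq_iUnion] at hu
    have : Nonempty c := hne.to_subtype
    obtain ⟨s, hs⟩ := isCompact_univ.elim_directed_cover (fun s : c => (s : Set X))
      (fun s => (hc s.2).1) hu.symm.subset hchain.directed
    exact (hc s.2).2.2 (univ_subset_iff.1 hs)) V₀ hS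
  obtain ⟨hVo, hVc, hVne⟩ := hV.prop
  have hVnonempty : V.Nonempty := ⟨a, hV₀V haV₀⟩
  have hncl : ¬ IsClosed V := fun h => hVne (IsClopen.eq_univ ⟨h, hVo⟩ hVnonempty)
  obtain ⟨p, hpcl, hpV⟩ : ∃ p, p ∈ closure V ∧ p ∉ V := by
    by_contra! hcon
    exact hncl (closure_subset_iff_isClosed.1 hcon)
  refine ⟨p, ?_⟩
  have : V = {p}ᶜ := by
    refine subset_antisymm (fun x hx (hxp : x = p) => hpV (by rwa [← hxp])) fun x hx => ?_
    obtain ⟨U, hU, hUo, hUc, hpU⟩ := nbhd p {x}ᶜ isOpen_compl_singleton (Ne.symm hx)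
    obtain ⟨q, hqU, hqV⟩ := mem_closure_iff.1 hpcl U hUo hpU
    have huniv : V ∪ U = univ := by
      by_contra hne
      have hmem : V ∪ U ∈ S := ⟨hVo.union hUo, hVc.union q hqV hqU hUc, hne⟩
      exact hpV (hV.le_of_ge hmem subset_union_left (mem_union_right _ hpU))
    have hx' : x ∈ V ∪ U := huniv ▸ mem_univ x
    exact hx'.resolve_right fun h => hU h rfl
  exact this ▸ hVc

section Arc

variable {X : Type*} [TopologicalSpace X] {ψ : OpenPartialHomeomorph X ℝ}
  {a' a b b' : ℝ}

theorem isPreconnected_symm_image {s : Set ℝ} (hs : s ⊆ ψ.target) (h : IsPreconnected s) :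
    IsPreconnected (ψ.symm '' s) :=
  h.image _ (ψ.continuousOn_symm.mono hs)

theorem isOpen_symm_image {s : Set ℝ} (hs : s ⊆ ψ.target) (h : IsOpen s) :
    IsOpen (ψ.symm '' s) :=
  ψ.symm.isOpen_image_of_subset_source h hs

theorem isClosed_symm_image_Icc [T2Space X] (h : Icc a b ⊆ ψ.target) :
    IsClosed (ψ.symm '' Icc a b) :=
  (isCompact_Icc.image_of_continuousOn (ψ.continuousOn_symm.mono h)).isClosed

theorem symm_mem_symm_image {s : Set ℝ} {t : ℝ} (hs : s ⊆ ψ.target) (ht : t ∈ ψ.target) :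
    ψ.symm t ∈ ψ.symm '' s ↔ t ∈ s :=
  ⟨fun ⟨_, hr, h⟩ => ψ.symm.injOn (hs hr) ht h ▸ hr, fun h => ⟨t, h, rfl⟩⟩

/-- A two-valued continuous function off the arc extends to the complement of a point of the arc,
by its constant values at the two sides. -/
theorem isPreconnected_compl_arc_of_compl_singleton [T2Space X] (ha : a' < a) (hb : b < b')
    (h : Ioo a' b' ⊆ ψ.target) {c : ℝ} (hc : c ∈ Icc a b)
    (hpre : IsPreconnected ({ψ.symm c}ᶜ : Set X)) :
    IsPreconnected ((ψ.symm '' Icc a b)ᶜ) := by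
  have hsub : Icc a b ⊆ ψ.target := fun t ht => h ⟨ha.trans_le ht.1, ht.2.trans_lt hb⟩
  have hab : a ≤ b := hc.1.trans hc.2
  have hct : c ∈ ψ.target := hsub hc
  set J := ψ.symm '' Icc a b with hJ
  have hJc : IsClosed J := isClosed_symm_image_Icc hsub
  have h₁ : Ioo a' c ⊆ ψ.target := fun t ht => h ⟨ht.1, ht.2.trans (hc.2.trans_lt hb)⟩
  have h₂ : Ioo c b' ⊆ ψ.target := fun t ht => h ⟨(ha.trans_le hc.1).trans ht.1, ht.2⟩
  refine isPreconnected_of_forall_constant fun f hf => ?_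
  obtain ⟨l, hl⟩ := nonempty_Ioo.2 ha
  obtain ⟨r, hr⟩ := nonempty_Ioo.2 hb
  have hJ' : ∀ t ∈ Ioo a' b', t ∉ Icc a b → ψ.symm t ∈ Jᶜ := fun t ht hn =>
    fun h' => hn ((symm_mem_symm_image hsub (h ht)).1 h')
  have hL : ∀ t ∈ Ioo a' c, t ∉ Icc a b → f (ψ.symm t) = f (ψ.symm l) := by
    intro t ht hn
    have hlt : ∀ t ∈ Ioo a' a, ψ.symm t ∈ Jᶜ := fun t ht =>
      hJ' t ⟨ht.1, ht.2.trans_le (hab.trans hb.le)⟩ fun h' => ht.2.not_ge h'.1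
    have ht' : t ∈ Ioo a' a := ⟨ht.1, by
      by_contra! hge
      exact hn ⟨hge, ht.2.le.trans hc.2⟩⟩
    exact (isPreconnected_symm_image (fun t ht => h ⟨ht.1, ht.2.trans_le (hab.trans hb.le)⟩)
      isPreconnected_Ioo).constant_of_mapsTo IsDiscrete.univ (hf.mono (by
        rintro _ ⟨t, ht, rfl⟩; exact hlt t ht)) (mapsTo_univ _ _) ⟨t, ht', rfl⟩ ⟨l, hl, rfl⟩
  have hR : ∀ t ∈ Ioo c b', t ∉ Icc a b → f (ψ.symm t) = f (ψ.symm r) := by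
    intro t ht hn
    have hrt : ∀ t ∈ Ioo b b', ψ.symm t ∈ Jᶜ := fun t ht =>
      hJ' t ⟨(ha.le.trans hab).trans_lt ht.1, ht.2⟩ fun h' => ht.1.not_ge h'.2
    have ht' : t ∈ Ioo b b' := ⟨by
      by_contra! hge
      exact hn ⟨hc.1.trans ht.1.le, hge⟩, ht.2⟩
    exact (isPreconnected_symm_image (fun t ht => h ⟨(ha.le.trans hab).trans_lt ht.1, ht.2⟩)
      isPreconnected_Ioo).constant_of_mapsTo IsDiscrete.univ (hf.mono (by
        rintro _ ⟨t, ht, rfl⟩; exact hrt t ht)) (mapsTo_univ _ _) ⟨t, ht', rfl⟩ ⟨r, hr, rfl⟩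
  classical
  -- the point of parameter `c` cuts the arc in two halves; `g` continues `f` constantly along each
  let g : X → Bool := fun x => if x ∈ ψ.symm '' Ioo a' c then f (ψ.symm l)
    else if x ∈ ψ.symm '' Ioo c b' then f (ψ.symm r) else f x
  have hgL : ∀ x ∈ ψ.symm '' Ioo a' c, g x = f (ψ.symm l) := fun x hx => if_pos hx
  have hgR : ∀ x ∈ ψ.symm '' Ioo c b', g x = f (ψ.symm r) := by
    rintro x ⟨t, ht, rfl⟩
    have : ψ.symm t ∉ ψ.symm '' Ioo a' c := by
      rw [symm_mem_symm_image h₁ (h₂ ht)]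
      exact fun h' => h'.2.not_gt ht.1
    simp only [g]
    rw [if_neg this, if_pos ⟨t, ht, rfl⟩]
  have hgJ : ∀ x ∈ Jᶜ, g x = f x := by
    intro x hx
    by_cases h1 : x ∈ ψ.symm '' Ioo a' c
    · rw [hgL x h1]
      obtain ⟨t, ht, rfl⟩ := h1
      exact (hL t ht fun h' => hx ⟨t, h', rfl⟩).symm
    by_cases h2 : x ∈ ψ.symm '' Ioo c b'
    · rw [hgR x h2]
      obtain ⟨t, ht, rfl⟩ := h2
      exact (hR t ht fun h' => hx ⟨t, h', rfl⟩).symm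
    simp only [g]
    rw [if_neg h1, if_neg h2]
  have hg : ContinuousOn g {ψ.symm c}ᶜ := by
    refine continuousOn_of_forall_continuousAt fun x hx => ?_
    by_cases hxJ : x ∈ J
    · obtain ⟨t, ht, rfl⟩ := hxJ
      rcases lt_trichotomy t c with htc | rfl | htc
      · refine (continuousAt_const (y := f (ψ.symm l))).congr ?_
        filter_upwards [(isOpen_symm_image h₁ isOpen_Ioo).mem_nhds
          ⟨t, ⟨ha.trans_le ht.1, htc⟩, rfl⟩] with x hx
        exact (hgL x hx).symm
      · exact absurd rfl hx
      · refine (continuousAt_const (y := f (ψ.symm r))).congr ?_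
        filter_upwards [(isOpen_symm_image h₂ isOpen_Ioo).mem_nhds
          ⟨t, ⟨htc, ht.2.trans_lt hb⟩, rfl⟩] with x hx
        exact (hgR x hx).symm
    · have hn : Jᶜ ∈ 𝓝 x := hJc.isOpen_compl.mem_nhds hxJ
      refine (hf.continuousAt hn).congr ?_
      filter_upwards [hn] with x hx
      exact (hgJ x hx).symm
  intro x hx y hy
  have hcJ : ∀ z ∈ Jᶜ, z ∈ ({ψ.symm c}ᶜ : Set X) := fun z hz hzc => hz (hzc ▸ ⟨c, hc, rfl⟩)
  rw [← hgJ x hx, ← hgJ y hy]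
  exact hpre.constant_of_mapsTo IsDiscrete.univ hg (mapsTo_univ _ _) (hcJ x hx) (hcJ y hy)

/-- The complement of a point of the arc is the union of the complement of the arc with the open
segments on both sides of the point, which reach out of the arc. -/
theorem isPreconnected_compl_singleton_of_compl_arc (ha : a' < a) (hb : b < b')
    (h : Ioo a' b' ⊆ ψ.target) {c : ℝ} (hc : c ∈ Icc a b)
    (hpre : IsPreconnected ((ψ.symm '' Icc a b)ᶜ)) :
    IsPreconnected ({ψ.symm c}ᶜ : Set X) := by
  have hsub : Icc a b ⊆ ψ.target := fun t ht => h ⟨ha.trans_le ht.1, ht.2.trans_lt hb⟩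
  have hab : a ≤ b := hc.1.trans hc.2
  have hct : c ∈ ψ.target := hsub hc
  have h₁ : Ioo a' c ⊆ ψ.target := fun t ht => h ⟨ht.1, ht.2.trans (hc.2.trans_lt hb)⟩
  have h₂ : Ioo c b' ⊆ ψ.target := fun t ht => h ⟨(ha.trans_le hc.1).trans ht.1, ht.2⟩
  obtain ⟨l, hl⟩ := nonempty_Ioo.2 ha
  obtain ⟨r, hr⟩ := nonempty_Ioo.2 hb
  have hlt : l ∈ Ioo a' b' := ⟨hl.1, hl.2.trans_le (hab.trans hb.le)⟩
  have hrt : r ∈ Ioo a' b' := ⟨(ha.le.trans hab).trans_lt hr.1, hr.2⟩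
  have key : ({ψ.symm c}ᶜ : Set X) =
      ((ψ.symm '' Icc a b)ᶜ ∪ ψ.symm '' Ioo a' c) ∪ ψ.symm '' Ioo c b' := by
    ext x
    constructor
    · intro hx
      by_cases hxJ : x ∈ ψ.symm '' Icc a b
      · obtain ⟨t, ht, rfl⟩ := hxJ
        rcases lt_trichotomy t c with htc | rfl | htc
        · exact Or.inl (Or.inr ⟨t, ⟨ha.trans_le ht.1, htc⟩, rfl⟩)
        · exact absurd rfl hx
        · exact Or.inr ⟨t, ⟨htc, ht.2.trans_lt hb⟩, rfl⟩
      · exact Or.inl (Or.inl hxJ)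
    · rintro ((hx | ⟨t, ht, rfl⟩) | ⟨t, ht, rfl⟩) hxc
      · exact hx (hxc ▸ ⟨c, hc, rfl⟩)
      · exact ht.2.ne (ψ.symm.injOn (h₁ ht) hct hxc)
      · exact ht.1.ne' (ψ.symm.injOn (h₂ ht) hct hxc)
  rw [key]
  refine IsPreconnected.union (ψ.symm r) (Or.inl fun h' => ?_)
    ⟨r, ⟨hc.2.trans_lt hr.1, hr.2⟩, rfl⟩
    (IsPreconnected.union (ψ.symm l) (fun h' => ?_) ⟨l, ⟨hl.1, hl.2.trans_le hc.1⟩, rfl⟩ hpre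
      (isPreconnected_symm_image h₁ isPreconnected_Ioo))
    (isPreconnected_symm_image h₂ isPreconnected_Ioo)
  · exact ((symm_mem_symm_image hsub (h hrt)).1 h').2.not_gt hr.1
  · exact ((symm_mem_symm_image hsub (h hlt)).1 h').1.not_gt hl.2

/-- In a closed connected one-dimensional manifold the complement of an arc is connected. Whether
the complement of a point is connected does not change when the point moves along an arc, hence
does not depend on the point, and it is connected for at least one point. -/
theorem isPreconnected_compl_arc [T2Space X] [CompactSpace X] [ConnectedSpace X]
    [LocallyConnectedSpace X]
    (hX : ∀ x : X, ∃ ψ : OpenPartialHomeomorph X ℝ, x ∈ ψ.source)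
    (ψ : OpenPartialHomeomorph X ℝ) (ha : a' < a) (hab : a ≤ b) (hb : b < b')
    (h : Ioo a' b' ⊆ ψ.target) : IsPreconnected ((ψ.symm '' Icc a b)ᶜ) := by
  have hnt : Nontrivial X := by
    have h1 : a ∈ ψ.target := h ⟨ha, hab.trans_lt hb⟩
    obtain ⟨t, ht⟩ := nonempty_Ioo.2 ha
    have h2 : t ∈ ψ.target := h ⟨ht.1, ht.2.trans_le (hab.trans hb.le)⟩
    exact ⟨ψ.symm a, ψ.symm t, fun h' => ht.2.ne' (ψ.symm.injOn h1 h2 h')⟩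
  have hloc : ∀ x : X, ∀ᶠ y in 𝓝 x,
      (IsPreconnected ({y}ᶜ : Set X) ↔ IsPreconnected ({x}ᶜ : Set X)) := by
    intro x
    obtain ⟨ψ, hx⟩ := hX x
    obtain ⟨ε, hε, hball⟩ := Metric.isOpen_iff.1 ψ.open_target (ψ x) (ψ.map_source hx)
    rw [Real.ball_eq_Ioo] at hball
    have hI : Ioo (ψ x - ε / 2) (ψ x + ε / 2) ∈ 𝓝 (ψ x) :=
      Ioo_mem_nhds (by linarith) (by linarith)
    filter_upwards [ψ.continuousAt hx hI, ψ.open_source.mem_nhds hx] with y hy hys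
    have hy' : ψ y ∈ Icc (ψ x - ε / 2) (ψ x + ε / 2) := Ioo_subset_Icc_self hy
    have hx' : ψ x ∈ Icc (ψ x - ε / 2) (ψ x + ε / 2) := ⟨by linarith, by linarith⟩
    have h1 : ψ x - ε < ψ x - ε / 2 := by linarith
    have h2 : ψ x + ε / 2 < ψ x + ε := by linarith
    have key : ∀ s ∈ Icc (ψ x - ε / 2) (ψ x + ε / 2), ∀ t ∈ Icc (ψ x - ε / 2) (ψ x + ε / 2),
        IsPreconnected ({ψ.symm s}ᶜ : Set X) → IsPreconnected ({ψ.symm t}ᶜ : Set X) :=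
      fun s hs t ht hp => isPreconnected_compl_singleton_of_compl_arc h1 h2 hball ht
        (isPreconnected_compl_arc_of_compl_singleton h1 h2 hball hs hp)
    have h3 := key _ hy' _ hx'
    have h4 := key _ hx' _ hy'
    rw [ψ.left_inv hx, ψ.left_inv hys] at h3 h4
    exact ⟨h3, h4⟩
  have hclopen : IsClopen {x : X | IsPreconnected ({x}ᶜ : Set X)} := by
    constructor
    · rw [← isOpen_compl_iff, isOpen_iff_mem_nhds]
      intro x hx
      filter_upwards [hloc x] with y hy
      exact fun h' => hx (hy.1 h')
    · rw [isOpen_iff_mem_nhds]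
      intro x hx
      filter_upwards [hloc x] with y hy
      exact hy.2 hx
  obtain ⟨p, hp⟩ := exists_isPreconnected_compl_singleton (X := X)
  have hall := hclopen.eq_univ ⟨p, hp⟩
  have hmem : ψ.symm a ∈ {x : X | IsPreconnected ({x}ᶜ : Set X)} := hall ▸ mem_univ _
  exact isPreconnected_compl_arc_of_compl_singleton ha hb h ⟨le_rfl, hab⟩ hmem

end Arc

/-! ### Calculus in a chart -/

section
variable {n : ℕ} {M : Type*} [TopologicalSpace M] [ChartedSpace (EuclideanSpace ℝ (Fin n)) M]
  [IsManifold (𝓡 n) ∞ M]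

/-- The tangent vector at `e.symm y` with coordinates `v` in the chart `e`. -/
noncomputable def coordVec (e : OpenPartialHomeomorph M (EuclideanSpace ℝ (Fin n)))
    (y v : EuclideanSpace ℝ (Fin n)) : TangentSpace (𝓡 n) (e.symm y) :=
  mfderiv (𝓡 n) (𝓡 n) e.symm y v

theorem chartGram_apply (h : SmoothMetric n M)
    (e : OpenPartialHomeomorph M (EuclideanSpace ℝ (Fin n))) (y : EuclideanSpace ℝ (Fin n))
    (i j : Fin n) :
    chartGram h e y i j = h.inner (e.symm y) (coordVec e y (EuclideanSpace.single i 1))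
      (coordVec e y (EuclideanSpace.single j 1)) :=
  rfl

theorem symmL_trivializationAt_eq_coordVec (p : M) {y : EuclideanSpace ℝ (Fin n)}
    (hy : y ∈ (chartAt (EuclideanSpace ℝ (Fin n)) p).target) (v : EuclideanSpace ℝ (Fin n)) :
    (trivializationAt (EuclideanSpace ℝ (Fin n)) (fun x : M => TangentSpace (𝓡 n) x) p).symmL ℝ
      ((chartAt (EuclideanSpace ℝ (Fin n)) p).symm y) v =
      coordVec (chartAt (EuclideanSpace ℝ (Fin n)) p) y v := by
  have : IsManifold (𝓡 n) 1 M := .of_le (n := ∞) (by norm_cast)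
  have h1 := TangentBundle.symmL_trivializationAt (I := 𝓡 n) (𝕜 := ℝ)
    ((chartAt (EuclideanSpace ℝ (Fin n)) p).map_target hy)
  have h2 := congrArg (fun f => f v) h1
  refine h2.trans ?_
  simp only [modelWithCornersSelf_coe, range_id, mfderivWithin_univ, extChartAt, mfld_simps,
    OpenPartialHomeomorph.extend]
  rw [(chartAt (EuclideanSpace ℝ (Fin n)) p).right_inv hy]
  rfl

theorem mdifferentiableAt_chart_symm (p : M) {y : EuclideanSpace ℝ (Fin n)}
    (hy : y ∈ (chartAt (EuclideanSpace ℝ (Fin n)) p).target) :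
    MDifferentiableAt (𝓡 n) (𝓡 n) (chartAt (EuclideanSpace ℝ (Fin n)) p).symm y :=
  ((contMDiffOn_chart_symm (I := 𝓡 n) (n := ∞) (x := p)).contMDiffAt
    ((chartAt _ p).open_target.mem_nhds hy)).mdifferentiableAt (by simp)

theorem mdifferentiableAt_chart (p : M) {x : M}
    (hx : x ∈ (chartAt (EuclideanSpace ℝ (Fin n)) p).source) :
    MDifferentiableAt (𝓡 n) (𝓡 n) (chartAt (EuclideanSpace ℝ (Fin n)) p) x :=
  ((contMDiffOn_chart (I := 𝓡 n) (n := ∞) (x := p)).contMDiffAt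
    ((chartAt _ p).open_source.mem_nhds hx)).mdifferentiableAt (by simp)

theorem coordVec_ne_zero (p : M) {y : EuclideanSpace ℝ (Fin n)}
    (hy : y ∈ (chartAt (EuclideanSpace ℝ (Fin n)) p).target) {v : EuclideanSpace ℝ (Fin n)}
    (hv : v ≠ 0) : coordVec (chartAt (EuclideanSpace ℝ (Fin n)) p) y v ≠ 0 := by
  rw [← symmL_trivializationAt_eq_coordVec p hy]
  intro h0
  have h1 := (trivializationAt (EuclideanSpace ℝ (Fin n))
    (fun x : M => TangentSpace (𝓡 n) x) p).continuousLinearMapAt_symmL (R := ℝ)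
    (b := (chartAt (EuclideanSpace ℝ (Fin n)) p).symm y)
    (by simpa using (chartAt (EuclideanSpace ℝ (Fin n)) p).map_target hy) v
  rw [h0, map_zero] at h1
  exact hv h1.symm

theorem contDiffOn_inner_coordVec (h : SmoothMetric n M) (p : M)
    (v w : EuclideanSpace ℝ (Fin n)) :
    ContDiffOn ℝ ∞ (fun y => h.inner ((chartAt (EuclideanSpace ℝ (Fin n)) p).symm y)
      (coordVec (chartAt (EuclideanSpace ℝ (Fin n)) p) y v)
      (coordVec (chartAt (EuclideanSpace ℝ (Fin n)) p) y w))
      (chartAt (EuclideanSpace ℝ (Fin n)) p).target := by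
  let : RiemannianBundle (fun x : M => TangentSpace (𝓡 n) x) := ⟨h.toRiemannianMetric⟩
  have : IsContMDiffRiemannianBundle (𝓡 n) ∞ (EuclideanSpace ℝ (Fin n))
      (fun x : M => TangentSpace (𝓡 n) x) := ⟨h.inner, h.contMDiff, fun _ _ _ => rfl⟩
  set e := chartAt (EuclideanSpace ℝ (Fin n)) p
  set t := trivializationAt (EuclideanSpace ℝ (Fin n)) (fun x : M => TangentSpace (𝓡 n) x) p
    with ht
  have hbase : t.baseSet = e.source := by simp [ht, e]
  have hs : ∀ v : EuclideanSpace ℝ (Fin n),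
      ContMDiffOn (𝓡 n) ((𝓡 n).prod 𝓘(ℝ, EuclideanSpace ℝ (Fin n))) ∞
        (fun x => (⟨x, t.symmL ℝ x v⟩ : TangentBundle (𝓡 n) M)) t.baseSet := by
    intro v
    rw [t.contMDiffOn_section_baseSet_iff]
    refine (contMDiffOn_const (c := v)).congr fun x hx => ?_
    exact t.continuousLinearMapAt_symmL (R := ℝ) hx v ▸ by simp [hx]
  have hsm := (hs v).inner_bundle (hs w)
  rw [hbase] at hsm
  have hcomp := hsm.comp (contMDiffOn_chart_symm (I := 𝓡 n) (n := ∞) (x := p))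
    (fun y hy => e.map_target hy)
  refine (contMDiffOn_iff_contDiffOn.1 hcomp).congr fun y hy => ?_
  simp only [Function.comp_apply]
  rw [← symmL_trivializationAt_eq_coordVec p hy, ← symmL_trivializationAt_eq_coordVec p hy]
  rfl

theorem contDiffOn_chartGram (h : SmoothMetric n M) (p : M) (i j : Fin n) :
    ContDiffOn ℝ ∞ (fun y => chartGram h (chartAt (EuclideanSpace ℝ (Fin n)) p) y i j)
      (chartAt (EuclideanSpace ℝ (Fin n)) p).target :=
  contDiffOn_inner_coordVec h p _ _

/-- The derivative of `φ` in the direction of a coordinate vector is the directional derivative of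
the coordinate expression of `φ`. -/
theorem mfderiv_coordVec {φ : M → ℝ} (hφ : ContMDiff (𝓡 n) 𝓘(ℝ, ℝ) ∞ φ) (p : M)
    {y : EuclideanSpace ℝ (Fin n)} (hy : y ∈ (chartAt (EuclideanSpace ℝ (Fin n)) p).target)
    (v : EuclideanSpace ℝ (Fin n)) :
    (show ℝ from mfderiv (𝓡 n) 𝓘(ℝ, ℝ) φ ((chartAt (EuclideanSpace ℝ (Fin n)) p).symm y)
      (coordVec (chartAt (EuclideanSpace ℝ (Fin n)) p) y v)) =
      fderiv ℝ (φ ∘ (chartAt (EuclideanSpace ℝ (Fin n)) p).symm) y v := by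
  rw [← mfderiv_eq_fderiv, mfderiv_comp y (hφ.mdifferentiableAt (by simp))
    (mdifferentiableAt_chart_symm p hy)]
  rfl

theorem contDiffOn_comp_chart_symm {φ : M → ℝ} (hφ : ContMDiff (𝓡 n) 𝓘(ℝ, ℝ) ∞ φ) (p : M) :
    ContDiffOn ℝ ∞ (φ ∘ (chartAt (EuclideanSpace ℝ (Fin n)) p).symm)
      (chartAt (EuclideanSpace ℝ (Fin n)) p).target :=
  contMDiffOn_iff_contDiffOn.1 (hφ.comp_contMDiffOn
    (contMDiffOn_chart_symm (I := 𝓡 n) (n := ∞) (x := p)))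

theorem coordVec_eq_sum (e : OpenPartialHomeomorph M (EuclideanSpace ℝ (Fin n)))
    (y v : EuclideanSpace ℝ (Fin n)) :
    coordVec e y v = ∑ i, v i • coordVec e y (EuclideanSpace.single i 1) := by
  have hv : v = ∑ i, v i • EuclideanSpace.single i (1 : ℝ) := by
    ext j
    simp [Finset.sum_apply, Pi.single_apply]
  conv_lhs => rw [hv]
  unfold coordVec
  exact (map_sum (mfderiv (𝓡 n) (𝓡 n) e.symm y) _ _).trans
    (Finset.sum_congr rfl fun i _ => map_smul _ _ _)

theorem inner_coordVec (h : SmoothMetric n M)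
    (e : OpenPartialHomeomorph M (EuclideanSpace ℝ (Fin n))) (y v w : EuclideanSpace ℝ (Fin n)) :
    h.inner (e.symm y) (coordVec e y v) (coordVec e y w) =
      v.ofLp ⬝ᵥ (chartGram h e y).mulVec w.ofLp := by
  rw [coordVec_eq_sum e y v, coordVec_eq_sum e y w]
  simp only [map_sum, map_smul, _root_.sum_apply, _root_.smul_apply, smul_eq_mul, dotProduct,
    Matrix.mulVec, chartGram_apply, Finset.mul_sum]
  rw [Finset.sum_comm]
  refine Finset.sum_congr rfl fun i _ => Finset.sum_congr rfl fun j _ => ?_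
  ring

theorem posDef_chartGram (h : SmoothMetric n M) (p : M) {y : EuclideanSpace ℝ (Fin n)}
    (hy : y ∈ (chartAt (EuclideanSpace ℝ (Fin n)) p).target) :
    (chartGram h (chartAt (EuclideanSpace ℝ (Fin n)) p) y).PosDef := by
  refine Matrix.PosDef.of_dotProduct_mulVec_pos ?_ fun v hv => ?_
  · ext i j
    simp only [Matrix.conjTranspose_apply, star_trivial, chartGram_apply]
    exact h.symm _ _ _
  · have := inner_coordVec h (chartAt (EuclideanSpace ℝ (Fin n)) p) y (WithLp.toLp 2 v)
      (WithLp.toLp 2 v)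
    simp only [star_trivial]
    rw [← this]
    exact h.pos _ _ (coordVec_ne_zero p hy (by simpa using hv))

/-- Change of chart for the Gram matrices. -/
theorem chartGram_det_eq (h : SmoothMetric n M) (p q : M) {y : EuclideanSpace ℝ (Fin n)}
    (hy : y ∈ (chartAt (EuclideanSpace ℝ (Fin n)) p).target)
    (hyq : (chartAt (EuclideanSpace ℝ (Fin n)) p).symm y ∈
      (chartAt (EuclideanSpace ℝ (Fin n)) q).source) :
    (chartGram h (chartAt (EuclideanSpace ℝ (Fin n)) p) y).det =
      (fderiv ℝ (chartAt (EuclideanSpace ℝ (Fin n)) q ∘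
          (chartAt (EuclideanSpace ℝ (Fin n)) p).symm) y).det ^ 2 *
        (chartGram h (chartAt (EuclideanSpace ℝ (Fin n)) q)
          (chartAt (EuclideanSpace ℝ (Fin n)) q
            ((chartAt (EuclideanSpace ℝ (Fin n)) p).symm y))).det := by
  set e := chartAt (EuclideanSpace ℝ (Fin n)) p with he
  set e' := chartAt (EuclideanSpace ℝ (Fin n)) q with he'
  set L := fderiv ℝ (e' ∘ e.symm) y with hL
  have hmem : ∀ᶠ z in 𝓝 y, e.symm z ∈ e'.source :=
    (e.continuousAt_symm hy).eventually (e'.open_source.mem_nhds hyq)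
  have hcv : ∀ v, (coordVec e y v : EuclideanSpace ℝ (Fin n)) =
      coordVec e' (e' (e.symm y)) (L v) := by
    intro v
    have h1 : e.symm =ᶠ[𝓝 y] e'.symm ∘ (e' ∘ e.symm) := by
      filter_upwards [hmem] with z hz
      simp [e'.left_inv hz]
    have h2 : MDifferentiableAt (𝓡 n) (𝓡 n) (e' ∘ e.symm) y :=
      (mdifferentiableAt_chart q hyq).comp y (mdifferentiableAt_chart_symm p hy)
    have h3 : MDifferentiableAt (𝓡 n) (𝓡 n) e'.symm ((e' ∘ e.symm) y) :=
      mdifferentiableAt_chart_symm q (e'.map_source hyq)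
    unfold coordVec
    have h4 := h1.mfderiv_eq (I := 𝓡 n) (I' := 𝓡 n)
    rw [mfderiv_comp y h3 h2, mfderiv_eq_fderiv] at h4
    exact congrArg (fun f => (f v : EuclideanSpace ℝ (Fin n))) h4
  have hinner : ∀ v w, h.inner (e.symm y) (coordVec e y v) (coordVec e y w) =
      h.inner (e'.symm (e' (e.symm y))) (coordVec e' (e' (e.symm y)) (L v))
        (coordVec e' (e' (e.symm y)) (L w)) := by
    intro v w
    rw [← hcv, ← hcv, e'.left_inv hyq]
  set b := EuclideanSpace.basisFun (Fin n) ℝ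
  set A := LinearMap.toMatrix b.toBasis b.toBasis (L : EuclideanSpace ℝ (Fin n) →ₗ[ℝ] _) with hA
  have hgram : chartGram h e y = A.transpose * chartGram h e' (e' (e.symm y)) * A := by
    ext i j
    rw [chartGram_apply, hinner, inner_coordVec]
    have hAi : ∀ i, (L (EuclideanSpace.single i 1)).ofLp = A.col i := by
      intro i
      ext k
      simp [hA, LinearMap.toMatrix_apply, b, Matrix.col]
    rw [hAi, hAi, Matrix.mul_assoc, Matrix.mul_apply, dotProduct]
    refine Finset.sum_congr rfl fun k _ => ?_
    rfl
  rw [hgram, Matrix.det_mul, Matrix.det_mul, Matrix.det_transpose]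
  have hdet : A.det = L.det := by
    rw [hA, LinearMap.det_toMatrix]
  rw [hdet]
  ring

end

/-! ### The Riemannian volume in a chart -/

section
variable {n : ℕ} {M : Type*} [TopologicalSpace M] [ChartedSpace (EuclideanSpace ℝ (Fin n)) M]
  [IsManifold (𝓡 n) ∞ M] [MeasurableSpace M] [BorelSpace M]

theorem continuousOn_sqrt_det_chartGram (h : SmoothMetric n M) (p : M) :
    ContinuousOn (fun y => √(chartGram h (chartAt (EuclideanSpace ℝ (Fin n)) p) y).det)
      (chartAt (EuclideanSpace ℝ (Fin n)) p).target := by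
  refine Real.continuous_sqrt.comp_continuousOn ?_
  simp only [Matrix.det_apply]
  exact continuousOn_finsetSum _ fun σ _ => ContinuousOn.const_smul
    (continuousOn_finsetProd _ fun i _ => (contDiffOn_chartGram h p _ _).continuousOn) _

theorem sqrt_det_chartGram_pos (h : SmoothMetric n M) (p : M) {y : EuclideanSpace ℝ (Fin n)}
    (hy : y ∈ (chartAt (EuclideanSpace ℝ (Fin n)) p).target) :
    0 < √(chartGram h (chartAt (EuclideanSpace ℝ (Fin n)) p) y).det :=
  Real.sqrt_pos.2 (posDef_chartGram h p hy).det_pos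

theorem aemeasurable_density (h : SmoothMetric n M) (p : M) :
    AEMeasurable (fun y => ENNReal.ofReal
      √(chartGram h (chartAt (EuclideanSpace ℝ (Fin n)) p) y).det)
      ((volume : Measure (EuclideanSpace ℝ (Fin n))).restrict
        (chartAt (EuclideanSpace ℝ (Fin n)) p).target) :=
  ((continuousOn_sqrt_det_chartGram h p).aemeasurable
    (chartAt _ p).open_target.measurableSet).ennreal_ofReal

theorem aemeasurable_chart_symm (e : OpenPartialHomeomorph M (EuclideanSpace ℝ (Fin n)))
    {μ : Measure (EuclideanSpace ℝ (Fin n))} (hμ : μ ≪ volume.restrict e.target) :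
    AEMeasurable e.symm μ :=
  (e.continuousOn_symm.aemeasurable e.open_target.measurableSet).mono_ac hμ

theorem lintegral_chartVolume (h : SmoothMetric n M) (p : M) {g : M → ℝ≥0∞} (hg : Measurable g) :
    ∫⁻ x, g x ∂(chartVolume h (chartAt (EuclideanSpace ℝ (Fin n)) p)) =
      ∫⁻ y in (chartAt (EuclideanSpace ℝ (Fin n)) p).target,
        ENNReal.ofReal √(chartGram h (chartAt (EuclideanSpace ℝ (Fin n)) p) y).det *
          g ((chartAt (EuclideanSpace ℝ (Fin n)) p).symm y) := by
  unfold chartVolume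
  rw [lintegral_map' hg.aemeasurable
    (aemeasurable_chart_symm _ (withDensity_absolutelyContinuous _ _))]
  exact lintegral_withDensity_eq_lintegral_mul₀ (aemeasurable_density h p)
    (hg.comp_aemeasurable (aemeasurable_chart_symm _ Measure.AbsolutelyContinuous.rfl))

theorem measurableSet_target_inter_preimage
    (e : OpenPartialHomeomorph M (EuclideanSpace ℝ (Fin n))) {B : Set M} (hB : MeasurableSet B) :
    MeasurableSet (e.target ∩ e.symm ⁻¹' B) := by
  classical
  rcases isEmpty_or_nonempty M with hM | ⟨⟨x₀⟩⟩
  · have : e.target = ∅ := eq_empty_of_forall_notMem fun y _ => hM.elim (e.symm y)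
    simp [this]
  have hm : Measurable (e.target.piecewise e.symm fun _ => x₀) :=
    ContinuousOn.measurable_piecewise e.continuousOn_symm continuousOn_const
      e.open_target.measurableSet
  have : e.target ∩ e.symm ⁻¹' B = e.target ∩ (e.target.piecewise e.symm fun _ => x₀) ⁻¹' B := by
    ext y
    simp only [mem_inter_iff, mem_preimage, and_congr_right_iff]
    intro hy
    rw [piecewise_eq_of_mem _ _ _ hy]
  rw [this]
  exact e.open_target.measurableSet.inter (hm hB)

theorem chartVolume_apply (h : SmoothMetric n M)
    (e : OpenPartialHomeomorph M (EuclideanSpace ℝ (Fin n))) {B : Set M} (hB : MeasurableSet B) :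
    chartVolume h e B =
      ∫⁻ y in e.target ∩ e.symm ⁻¹' B, ENNReal.ofReal √(chartGram h e y).det := by
  unfold chartVolume
  rw [Measure.map_apply_of_aemeasurable
    (aemeasurable_chart_symm _ (withDensity_absolutelyContinuous _ _)) hB, withDensity_apply',
    Measure.restrict_restrict' e.open_target.measurableSet, inter_comm]

/-- The volume of a Borel set in the domains of two charts is the same in both charts. -/
theorem chartVolume_eq_of_subset (h : SmoothMetric n M) (p q : M) {B : Set M}
    (hB : MeasurableSet B) (hp : B ⊆ (chartAt (EuclideanSpace ℝ (Fin n)) p).source)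
    (hq : B ⊆ (chartAt (EuclideanSpace ℝ (Fin n)) q).source) :
    chartVolume h (chartAt (EuclideanSpace ℝ (Fin n)) p) B =
      chartVolume h (chartAt (EuclideanSpace ℝ (Fin n)) q) B := by
  rw [chartVolume_apply h _ hB, chartVolume_apply h _ hB]
  set e := chartAt (EuclideanSpace ℝ (Fin n)) p with he
  set e' := chartAt (EuclideanSpace ℝ (Fin n)) q with he'
  set S := e.target ∩ e.symm ⁻¹' B with hS
  have hSm : MeasurableSet S := measurableSet_target_inter_preimage e hB
  have himage : e'.target ∩ e'.symm ⁻¹' B = (e' ∘ e.symm) '' S := by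
    ext z
    constructor
    · rintro ⟨hz, hzB⟩
      refine ⟨e (e'.symm z), ⟨e.map_source (hp hzB), ?_⟩, ?_⟩
      · rw [mem_preimage, e.left_inv (hp hzB)]
        exact hzB
      · simp only [Function.comp_apply]
        rw [e.left_inv (hp hzB), e'.right_inv hz]
    · rintro ⟨y, ⟨_, hyB⟩, rfl⟩
      refine ⟨e'.map_source (hq hyB), ?_⟩
      simp only [mem_preimage, Function.comp_apply]
      rw [e'.left_inv (hq hyB)]
      exact hyB
  have hinj : InjOn (e' ∘ e.symm) S := by
    intro y hy z hz hyz
    exact e.symm.injOn hy.1 hz.1 (e'.injOn (hq hy.2) (hq hz.2) hyz)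
  have hderiv : ∀ y ∈ S, HasFDerivWithinAt (e' ∘ e.symm) (fderiv ℝ (e' ∘ e.symm) y) S y := by
    intro y hy
    have h2 : MDifferentiableAt (𝓡 n) (𝓡 n) (e' ∘ e.symm) y :=
      (mdifferentiableAt_chart q (hq hy.2)).comp y (mdifferentiableAt_chart_symm p hy.1)
    exact (mdifferentiableAt_iff_differentiableAt.1 h2).hasFDerivAt.hasFDerivWithinAt
  rw [himage, lintegral_image_eq_lintegral_abs_det_fderiv_mul volume hSm hderiv hinj]
  refine setLIntegral_congr_fun hSm fun y hy => ?_
  simp only [Function.comp_apply]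
  rw [chartGram_det_eq h p q hy.1 (hq hy.2), Real.sqrt_mul (sq_nonneg _), Real.sqrt_sq_eq_abs,
    ENNReal.ofReal_mul (abs_nonneg _)]

variable [SecondCountableTopology M] [Nonempty M]

theorem riemannianVolume_apply (h : SmoothMetric n M) (p : M) {B : Set M}
    (hB : MeasurableSet B) (hp : B ⊆ (chartAt (EuclideanSpace ℝ (Fin n)) p).source) :
    riemannianVolume h B = chartVolume h (chartAt (EuclideanSpace ℝ (Fin n)) p) B := by
  set s : ℕ → Set M := fun k => (chartAt (EuclideanSpace ℝ (Fin n)) (coverPoint n M k)).source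
    with hs
  have hsm : ∀ k, MeasurableSet (disjointed s k) :=
    MeasurableSet.disjointed fun k => (chartAt _ (coverPoint n M k)).open_source.measurableSet
  have hunion : ⋃ k, disjointed s k = univ := by
    rw [iUnion_disjointed]
    exact (exists_seq_chart_cover n M).choose_spec
  unfold riemannianVolume
  rw [Measure.sum_apply _ hB]
  have hterm : ∀ k, (chartVolume h (chartAt (EuclideanSpace ℝ (Fin n)) (coverPoint n M k))).restrict
      (disjointed s k) B =
      chartVolume h (chartAt (EuclideanSpace ℝ (Fin n)) p) (B ∩ disjointed s k) := by
    intro k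
    rw [Measure.restrict_apply hB]
    exact chartVolume_eq_of_subset h _ p (hB.inter (hsm k))
      (inter_subset_right.trans (disjointed_subset s k)) (inter_subset_left.trans hp)
  rw [tsum_congr hterm]
  rw [← measure_iUnion (fun i j hij => (disjoint_disjointed s hij).mono
    inter_subset_right inter_subset_right) (fun k => hB.inter (hsm k)), ← inter_iUnion, hunion,
    inter_univ]

theorem restrict_riemannianVolume (h : SmoothMetric n M) (p : M) :
    (riemannianVolume h).restrict (chartAt (EuclideanSpace ℝ (Fin n)) p).source =
      chartVolume h (chartAt (EuclideanSpace ℝ (Fin n)) p) := by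
  set e := chartAt (EuclideanSpace ℝ (Fin n)) p with he
  have hsrc : MeasurableSet e.source := e.open_source.measurableSet
  ext B hB
  rw [Measure.restrict_apply hB, riemannianVolume_apply h p (hB.inter hsrc) inter_subset_right,
    chartVolume_apply h _ hB, chartVolume_apply h _ (hB.inter hsrc)]
  congr 2
  ext y
  exact ⟨fun hy => ⟨hy.1, hy.2.1⟩, fun hy => ⟨hy.1, hy.2, e.map_target hy.1⟩⟩

/-- On a compact set of a chart the Lebesgue measure is dominated by the Riemannian volume. -/
theorem exists_setLIntegral_le (h : SmoothMetric n M) (p : M) {K : Set (EuclideanSpace ℝ (Fin n))}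
    (hK : IsCompact K) (hKt : K ⊆ (chartAt (EuclideanSpace ℝ (Fin n)) p).target) :
    ∃ C : ℝ≥0∞, C ≠ ⊤ ∧ ∀ g : M → ℝ≥0∞, Measurable g →
      ∫⁻ y in K, g ((chartAt (EuclideanSpace ℝ (Fin n)) p).symm y) ≤
        C * ∫⁻ x, g x ∂(riemannianVolume h) := by
  set e := chartAt (EuclideanSpace ℝ (Fin n)) p with he
  obtain ⟨C, hC⟩ := hK.exists_bound_of_continuousOn
    (((continuousOn_sqrt_det_chartGram h p).mono hKt).inv₀
      fun y hy => (sqrt_det_chartGram_pos h p (hKt hy)).ne')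
  refine ⟨ENNReal.ofReal C, ENNReal.ofReal_ne_top, fun g hg => ?_⟩
  calc ∫⁻ y in K, g (e.symm y)
      ≤ ∫⁻ y in K, ENNReal.ofReal C * (ENNReal.ofReal √(chartGram h e y).det * g (e.symm y)) := by
        refine setLIntegral_mono' hK.measurableSet fun y hy => ?_
        have hpos := sqrt_det_chartGram_pos h p (hKt hy)
        have h1 : 1 ≤ C * √(chartGram h e y).det := by
          have h2 := (le_abs_self _).trans (hC y hy)
          rw [Pi.inv_apply, inv_le_iff_one_le_mul₀ hpos] at h2
          exact h2
        rw [← mul_assoc, ← ENNReal.ofReal_mul' hpos.le]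
        exact le_mul_of_one_le_left zero_le (by simpa using ENNReal.ofReal_le_ofReal h1)
    _ ≤ ∫⁻ y in e.target, ENNReal.ofReal C *
          (ENNReal.ofReal √(chartGram h e y).det * g (e.symm y)) :=
        lintegral_mono_set hKt
    _ = ENNReal.ofReal C * ∫⁻ x, g x ∂(chartVolume h e) := by
        rw [lintegral_const_mul' _ _ ENNReal.ofReal_ne_top, ← lintegral_chartVolume h p hg]
    _ ≤ _ := by
        gcongr
        rw [← restrict_riemannianVolume h p]
        exact Measure.restrict_le_self

theorem isFiniteMeasure_riemannianVolume [CompactSpace M] (h : SmoothMetric n M) :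
    IsFiniteMeasure (riemannianVolume h) := by
  have : IsLocallyFiniteMeasure (riemannianVolume h) := by
    refine ⟨fun x => ?_⟩
    set e := chartAt (EuclideanSpace ℝ (Fin n)) x with he
    obtain ⟨r, hr, hrt⟩ := Metric.nhds_basis_closedBall.mem_iff.1
      (e.open_target.mem_nhds (mem_chart_target _ x))
    have hK : IsCompact (Metric.closedBall (e x) r) := isCompact_closedBall _ _
    refine ⟨e.source ∩ e ⁻¹' Metric.ball (e x) r, ?_, ?_⟩
    · exact Filter.inter_mem (e.open_source.mem_nhds (mem_chart_source _ x))
        (e.continuousAt (mem_chart_source _ x) (Metric.ball_mem_nhds _ hr))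
    have hm : MeasurableSet (e.source ∩ e ⁻¹' Metric.ball (e x) r) :=
      (e.isOpen_inter_preimage Metric.isOpen_ball).measurableSet
    obtain ⟨C, hC⟩ := hK.exists_bound_of_continuousOn
      ((continuousOn_sqrt_det_chartGram h x).mono hrt)
    rw [riemannianVolume_apply h x hm inter_subset_left, chartVolume_apply h _ hm]
    calc ∫⁻ y in e.target ∩ e.symm ⁻¹' (e.source ∩ e ⁻¹' Metric.ball (e x) r),
          ENNReal.ofReal √(chartGram h e y).det
        ≤ ∫⁻ y in Metric.closedBall (e x) r, ENNReal.ofReal √(chartGram h e y).det := by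
          refine lintegral_mono_set ?_
          rintro y ⟨hy, _, hyb⟩
          rw [mem_preimage, e.right_inv hy] at hyb
          exact Metric.ball_subset_closedBall hyb
      _ ≤ ∫⁻ y in Metric.closedBall (e x) r, ENNReal.ofReal C :=
          setLIntegral_mono' hK.measurableSet fun y hy =>
            ENNReal.ofReal_le_ofReal ((le_abs_self _).trans (hC y hy))
      _ < ⊤ := by
          rw [setLIntegral_const]
          exact ENNReal.mul_lt_top ENNReal.ofReal_lt_top hK.measure_lt_top
  infer_instance

theorem riemannianVolume_univ_ne_zero (h : SmoothMetric n M) : riemannianVolume h univ ≠ 0 := by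
  obtain ⟨x⟩ := ‹Nonempty M›
  set e := chartAt (EuclideanSpace ℝ (Fin n)) x with he
  obtain ⟨r, hr, hrt⟩ := Metric.nhds_basis_closedBall.mem_iff.1
    (e.open_target.mem_nhds (mem_chart_target _ x))
  obtain ⟨C, -, hC⟩ := exists_setLIntegral_le h x (isCompact_closedBall (e x) r) hrt
  intro h0
  have h1 := hC 1 measurable_one
  simp only [Pi.one_apply, lintegral_one, Measure.restrict_apply_univ, h0, mul_zero,
    nonpos_iff_eq_zero] at h1
  exact (Metric.measure_closedBall_pos volume (e x) hr).ne' h1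

end

/-! ### Continuity of gradients -/

section
variable {n : ℕ} {M : Type*} [TopologicalSpace M] [ChartedSpace (EuclideanSpace ℝ (Fin n)) M]
  [IsManifold (𝓡 n) ∞ M]

theorem continuousOn_fderiv_comp_chart_symm {φ : M → ℝ} (hφ : ContMDiff (𝓡 n) 𝓘(ℝ, ℝ) ∞ φ)
    (p : M) (v : EuclideanSpace ℝ (Fin n)) :
    ContinuousOn (fun y => fderiv ℝ (φ ∘ (chartAt (EuclideanSpace ℝ (Fin n)) p).symm) y v)
      (chartAt (EuclideanSpace ℝ (Fin n)) p).target :=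
  ((contDiffOn_comp_chart_symm hφ p).continuousOn_fderiv_of_isOpen
    (chartAt _ p).open_target (by simp)).clm_apply continuousOn_const

/-- In a chart, the coordinates of the gradient are obtained from the partial derivatives by
applying the inverse of the Gram matrix. -/
theorem coords_gradient (h : SmoothMetric n M) {φ : M → ℝ} (hφ : ContMDiff (𝓡 n) 𝓘(ℝ, ℝ) ∞ φ)
    (p : M) {y : EuclideanSpace ℝ (Fin n)}
    (hy : y ∈ (chartAt (EuclideanSpace ℝ (Fin n)) p).target) :
    (trivializationAt (EuclideanSpace ℝ (Fin n)) (fun x : M => TangentSpace (𝓡 n) x) p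
      ⟨(chartAt (EuclideanSpace ℝ (Fin n)) p).symm y,
        gradient h φ ((chartAt (EuclideanSpace ℝ (Fin n)) p).symm y)⟩).2 =
      WithLp.toLp 2 ((chartGram h (chartAt (EuclideanSpace ℝ (Fin n)) p) y)⁻¹.mulVec fun j =>
        fderiv ℝ (φ ∘ (chartAt (EuclideanSpace ℝ (Fin n)) p).symm) y
          (EuclideanSpace.single j 1)) := by
  set e := chartAt (EuclideanSpace ℝ (Fin n)) p with he
  set t := trivializationAt (EuclideanSpace ℝ (Fin n)) (fun x : M => TangentSpace (𝓡 n) x) p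
    with ht
  have hb : e.symm y ∈ t.baseSet := by simpa [ht] using e.map_target hy
  set c := (t ⟨e.symm y, gradient h φ (e.symm y)⟩).2 with hc
  have hgrad : gradient h φ (e.symm y) = coordVec e y c := by
    rw [he, ← symmL_trivializationAt_eq_coordVec p hy, hc]
    have h1 := t.symmL_continuousLinearMapAt (R := ℝ) hb (gradient h φ (e.symm y))
    rw [t.continuousLinearMapAt_apply (R := ℝ), t.linearMapAt_apply (R := ℝ), if_pos hb] at h1
    exact h1.symm
  have hG : (chartGram h e y).mulVec c.ofLp = fun j =>
      fderiv ℝ (φ ∘ e.symm) y (EuclideanSpace.single j 1) := by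
    funext j
    rw [he, ← mfderiv_coordVec hφ p hy, ← inner_gradient h φ, h.symm, hgrad, inner_coordVec]
    simp
  have hdet : IsUnit (chartGram h e y).det := (posDef_chartGram h p hy).det_pos.ne'.isUnit
  rw [← hG, Matrix.mulVec_mulVec, Matrix.nonsing_inv_mul _ hdet, Matrix.one_mulVec]

theorem continuous_gradient (h : SmoothMetric n M) {φ : M → ℝ}
    (hφ : ContMDiff (𝓡 n) 𝓘(ℝ, ℝ) ∞ φ) :
    Continuous (fun x => (⟨x, gradient h φ x⟩ : TangentBundle (𝓡 n) M)) := by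
  rw [continuous_iff_continuousAt]
  intro p
  refine (FiberBundle.continuousAt_totalSpace _ _).2 ⟨continuousAt_id, ?_⟩
  set e := chartAt (EuclideanSpace ℝ (Fin n)) p with he
  have hG : ContinuousOn (fun y => chartGram h e y) e.target :=
    continuousOn_pi.2 fun i => continuousOn_pi.2 fun j =>
      (contDiffOn_chartGram h p i j).continuousOn
  have hdet : ContinuousOn (fun y => (chartGram h e y).det) e.target :=
    (Continuous.matrix_det continuous_id).comp_continuousOn hG
  have hinv : ContinuousOn (fun y => (chartGram h e y)⁻¹) e.target := by
    simp only [Matrix.inv_def, Ring.inverse_eq_inv']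
    exact (hdet.inv₀ fun y hy => (posDef_chartGram h p hy).det_pos.ne').smul
      ((Continuous.matrix_adjugate continuous_id).comp_continuousOn hG)
  have hcont : ContinuousOn (fun y => WithLp.toLp 2 ((chartGram h e y)⁻¹.mulVec fun j =>
      fderiv ℝ (φ ∘ e.symm) y (EuclideanSpace.single j 1))) e.target := by
    refine (PiLp.continuous_toLp 2 _).comp_continuousOn ?_
    have h1 : Continuous fun q : Matrix (Fin n) (Fin n) ℝ × (Fin n → ℝ) => q.1.mulVec q.2 :=
      continuous_fst.matrix_mulVec continuous_snd
    exact h1.comp_continuousOn (hinv.prodMk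
      (continuousOn_pi.2 fun j => continuousOn_fderiv_comp_chart_symm hφ p _))
  have hp : p ∈ e.source := mem_chart_source _ p
  have hcomp := (hcont.continuousAt (e.open_target.mem_nhds (e.map_source hp))).comp
    (e.continuousAt hp)
  refine hcomp.congr ?_
  filter_upwards [e.open_source.mem_nhds hp] with x hx
  have := coords_gradient h hφ p (e.map_source hx)
  simp only [Function.comp_apply]
  rw [← this, ← he, e.left_inv hx]

end

section
variable {n : ℕ} {M : Type*} [TopologicalSpace M] [ChartedSpace (EuclideanSpace ℝ (Fin n)) M]
  [IsManifold (𝓡 n) ∞ M] [MeasurableSpace M] [BorelSpace M]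

theorem isMeasurableField_gradient (h : SmoothMetric n M) {φ : M → ℝ}
    (hφ : ContMDiff (𝓡 n) 𝓘(ℝ, ℝ) ∞ φ) : IsMeasurableField (gradient h φ) := by
  let : MeasurableSpace (TangentBundle (𝓡 n) M) := borel _
  have : BorelSpace (TangentBundle (𝓡 n) M) := ⟨rfl⟩
  exact (continuous_gradient h hφ).measurable

/-- The gradient for one metric is square integrable for any other metric. -/
theorem gradient_mem_sqIntegrableFields [CompactSpace M] [SecondCountableTopology M]
    (h g : SmoothMetric n M) (μ : Measure M) [IsFiniteMeasure μ] {φ : M → ℝ}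
    (hφ : ContMDiff (𝓡 n) 𝓘(ℝ, ℝ) ∞ φ) : gradient h φ ∈ sqIntegrableFields g μ := by
  have hc : Continuous fun x => g.inner x (gradient h φ x) (gradient h φ x) :=
    (continuous_normSq g).comp (continuous_gradient h hφ)
  obtain ⟨C, hC⟩ := isCompact_univ.exists_bound_of_continuousOn hc.continuousOn
  exact ⟨isMeasurableField_gradient h hφ, Integrable.of_bound hc.measurable.aestronglyMeasurable C
    (ae_of_all _ fun x => hC x (mem_univ x))⟩

/-- Averaging a field over the fibres of the identity map does not change it. -/
theorem fibreAverage_id [StandardBorelSpace M] [Nonempty M] (μ : Measure M) [IsFiniteMeasure μ]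
    (v : VField n M) : fibreAverage (id : M → M) μ v =ᵐ[μ] v := by
  have h1 := condDistrib_self (μ := μ) (id : M → M)
  rw [Measure.map_id] at h1
  filter_upwards [h1] with y hy
  have h2 : ∀ f : M → EuclideanSpace ℝ (Fin n),
      ∫ x in id ⁻¹' {y}, f x ∂(condDistrib id id μ y) = f y := by
    classical
    intro f
    rw [hy, Kernel.id_apply, preimage_id, setIntegral_dirac, if_pos (mem_singleton y)]
  refine (h2 _).trans ?_
  rw [mfderiv_id]
  rfl

end

/-! ### Normalized volume -/

section
variable {n : ℕ} {M : Type*} [TopologicalSpace M] [ChartedSpace (EuclideanSpace ℝ (Fin n)) M]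
  [IsManifold (𝓡 n) ∞ M] [MeasurableSpace M] [BorelSpace M] [SecondCountableTopology M]
  [CompactSpace M] [ConnectedSpace M]

/-- The normalized Riemannian volume as a point of the Wasserstein space. -/
noncomputable def normalizedVolume (h : SmoothMetric n M) : WassersteinSpace h :=
  ⟨(riemannianVolume h univ)⁻¹ • riemannianVolume h, by
    have := isFiniteMeasure_riemannianVolume h
    have hp : IsProbabilityMeasure ((riemannianVolume h univ)⁻¹ • riemannianVolume h) := ⟨by
      rw [Measure.smul_apply, smul_eq_mul, ENNReal.inv_mul_cancel
        (riemannianVolume_univ_ne_zero h) (measure_ne_top _ _)]⟩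
    refine ⟨hp, ?_⟩
    obtain ⟨y⟩ : Nonempty M := inferInstance
    obtain ⟨C, hC, hy⟩ := riemannianDist_bounded h y
    refine ⟨y, (lintegral_mono fun x => pow_le_pow_left' (hy x) 2).trans_lt ?_⟩
    rw [lintegral_const, measure_univ, mul_one]
    exact (ENNReal.pow_ne_top hC).lt_top⟩

end

/-! ### Approximation by gradients, read in a chart -/

section
variable {n : ℕ} {M : Type*} [TopologicalSpace M] [ChartedSpace (EuclideanSpace ℝ (Fin n)) M]
  [IsManifold (𝓡 n) ∞ M]

theorem sq_inner_le (h : SmoothMetric n M) (x : M) (v w : TangentSpace (𝓡 n) x) :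
    h.inner x v w ^ 2 ≤ h.inner x v v * h.inner x w w := by
  by_cases hw : w = 0
  · subst hw; simp
  have hpos := h.pos x w hw
  have h1 := normSq_nonneg h x (h.inner x w w • v - h.inner x v w • w)
  simp only [map_sub, map_smul, _root_.sub_apply, _root_.smul_apply, smul_eq_mul,
    h.symm x w v] at h1
  have h2 : 0 ≤ h.inner x w w * (h.inner x v v * h.inner x w w - h.inner x v w ^ 2) := by
    linarith
  linarith [nonneg_of_mul_nonneg_right h2 hpos]

/-- The covector dual for `h₂` to the difference of a gradient for the conformal metric `h₁` and a
gradient for `h₂`, in coordinates. -/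
theorem inner_gradient_sub_gradient {h₁ h₂ : SmoothMetric n M} {ν : M → ℝ}
    (hconf : ∀ (x : M) (v w : TangentSpace (𝓡 n) x), h₂.inner x v w = ν x ^ 2 * h₁.inner x v w)
    {φ ψ : M → ℝ} (hφ : ContMDiff (𝓡 n) 𝓘(ℝ, ℝ) ∞ φ) (hψ : ContMDiff (𝓡 n) 𝓘(ℝ, ℝ) ∞ ψ) (p : M)
    {y : EuclideanSpace ℝ (Fin n)} (hy : y ∈ (chartAt (EuclideanSpace ℝ (Fin n)) p).target)
    (v : EuclideanSpace ℝ (Fin n)) :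
    h₂.inner ((chartAt (EuclideanSpace ℝ (Fin n)) p).symm y)
      (gradient h₁ φ ((chartAt (EuclideanSpace ℝ (Fin n)) p).symm y) -
        gradient h₂ ψ ((chartAt (EuclideanSpace ℝ (Fin n)) p).symm y))
      (coordVec (chartAt (EuclideanSpace ℝ (Fin n)) p) y v) =
    ν ((chartAt (EuclideanSpace ℝ (Fin n)) p).symm y) ^ 2 *
        fderiv ℝ (φ ∘ (chartAt (EuclideanSpace ℝ (Fin n)) p).symm) y v -
      fderiv ℝ (ψ ∘ (chartAt (EuclideanSpace ℝ (Fin n)) p).symm) y v := by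
  rw [← mfderiv_coordVec hφ p hy, ← mfderiv_coordVec hψ p hy, ← inner_gradient h₁ φ,
    ← inner_gradient h₂ ψ, ← hconf, map_sub, _root_.sub_apply]

end

section
variable {n : ℕ} {M : Type*} [TopologicalSpace M] [ChartedSpace (EuclideanSpace ℝ (Fin n)) M]
  [IsManifold (𝓡 n) ∞ M] [MeasurableSpace M] [BorelSpace M] [SecondCountableTopology M]

/-- The squared distance in `L²(TM, μ)` is the integral of the squared norm of the difference. -/
theorem ofReal_dist_mk_sq {h : SmoothMetric n M} {μ : Measure M} (v w : L2Field h μ) :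
    ENNReal.ofReal (dist (SeparationQuotient.mk v : L2 h μ) (SeparationQuotient.mk w) ^ 2) =
      ∫⁻ x, ENNReal.ofReal
        (h.inner x (v.toField x - w.toField x) (v.toField x - w.toField x)) ∂μ := by
  rw [SeparationQuotient.dist_mk, dist_eq_norm]
  change ENNReal.ofReal
    (√(∫ x, h.inner x ((v - w).toField x) ((v - w).toField x) ∂μ) ^ 2) = _
  rw [Real.sq_sqrt (integral_nonneg fun x => normSq_nonneg h x _),
    ofReal_integral_eq_lintegral_ofReal (integrable_inner _ _)
      (ae_of_all _ fun x => normSq_nonneg h x _)]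
  rfl

/-- The class of a field in the tangent space is a mean square limit of gradients. -/
theorem exists_seq_of_mem_tangentSpace {h : SmoothMetric n M} (μ : WassersteinSpace h)
    (u : L2Field h μ.measure)
    (hu : (SeparationQuotient.mk u : L2 h μ.measure) ∈ μ.tangentSpace) :
    ∃ ψ : ℕ → M → ℝ, (∀ k, ContMDiff (𝓡 n) 𝓘(ℝ, ℝ) ∞ (ψ k)) ∧
      Filter.Tendsto (fun k => ∫⁻ x, ENNReal.ofReal (h.inner x
        (u.toField x - gradient h (ψ k) x) (u.toField x - gradient h (ψ k) x)) ∂μ.measure)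
        Filter.atTop (𝓝 0) := by
  obtain ⟨V, hV, hlim⟩ := mem_closure_iff_seq_limit.1 hu
  choose ψ hψ _ hcl using hV
  choose v hv hvV using hcl
  refine ⟨ψ, hψ, ?_⟩
  have h1 := tendsto_iff_dist_tendsto_zero.1 hlim
  have h2 := ENNReal.tendsto_ofReal (h1.pow 2)
  rw [zero_pow two_ne_zero, ENNReal.ofReal_zero] at h2
  refine h2.congr fun k => ?_
  rw [dist_comm, ← hvV k, ofReal_dist_mk_sq]
  refine lintegral_congr_ae ?_
  filter_upwards [hv k] with x hx
  rw [hx]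

/-- If gradients for `h₂` approximate the `h₁`-gradient of `φ` in the mean square, then in a chart
their coordinate covectors approximate `ν² dφ` in the mean on compact sets. -/
theorem tendsto_setLIntegral_enorm_sub [CompactSpace M] [Nonempty M] {h₁ h₂ : SmoothMetric n M}
    {ν : M → ℝ}
    (hconf : ∀ (x : M) (v w : TangentSpace (𝓡 n) x), h₂.inner x v w = ν x ^ 2 * h₁.inner x v w)
    {φ : M → ℝ} (hφ : ContMDiff (𝓡 n) 𝓘(ℝ, ℝ) ∞ φ) {ψ : ℕ → M → ℝ}
    (hψ : ∀ k, ContMDiff (𝓡 n) 𝓘(ℝ, ℝ) ∞ (ψ k))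
    (hlim : Filter.Tendsto (fun k => ∫⁻ x, ENNReal.ofReal (h₂.inner x
      (gradient h₁ φ x - gradient h₂ (ψ k) x) (gradient h₁ φ x - gradient h₂ (ψ k) x))
        ∂(riemannianVolume h₁)) Filter.atTop (𝓝 0))
    (p : M) {K : Set (EuclideanSpace ℝ (Fin n))} (hK : IsCompact K)
    (hKt : K ⊆ (chartAt (EuclideanSpace ℝ (Fin n)) p).target) (v : EuclideanSpace ℝ (Fin n)) :
    Filter.Tendsto (fun k => ∫⁻ y in K,
      ‖ν ((chartAt (EuclideanSpace ℝ (Fin n)) p).symm y) ^ 2 *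
          fderiv ℝ (φ ∘ (chartAt (EuclideanSpace ℝ (Fin n)) p).symm) y v -
        fderiv ℝ (ψ k ∘ (chartAt (EuclideanSpace ℝ (Fin n)) p).symm) y v‖ₑ)
      Filter.atTop (𝓝 0) := by
  have := isFiniteMeasure_riemannianVolume h₁
  set e := chartAt (EuclideanSpace ℝ (Fin n)) p with he
  set μ := riemannianVolume h₁ with hμ
  set Q : ℕ → M → ℝ := fun k x => h₂.inner x
      (gradient h₁ φ x - gradient h₂ (ψ k) x) (gradient h₁ φ x - gradient h₂ (ψ k) x) with hQ
  have hQm : ∀ k, Measurable (Q k) := fun k => by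
    have h1 := (isMeasurableField_gradient h₁ hφ).add
      ((isMeasurableField_gradient h₂ (hψ k)).smul (-1))
    convert! h1.normSq h₂ using 1
    funext x
    have h2 : (gradient h₁ φ + (-1 : ℝ) • gradient h₂ (ψ k)) x =
        gradient h₁ φ x - gradient h₂ (ψ k) x := by
      rw [neg_one_smul, sub_eq_add_neg]
      rfl
    rw [h2]
  have hQ0 : ∀ k x, 0 ≤ Q k x := fun k x => normSq_nonneg h₂ x _
  obtain ⟨B, hB⟩ := hK.exists_bound_of_continuousOn
    ((contDiffOn_inner_coordVec h₂ p v v).continuousOn.mono hKt)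
  obtain ⟨C, hCtop, hC⟩ := exists_setLIntegral_le h₁ p hK hKt
  have hpt : ∀ k, ∀ y ∈ K, ‖ν (e.symm y) ^ 2 * fderiv ℝ (φ ∘ e.symm) y v -
      fderiv ℝ (ψ k ∘ e.symm) y v‖ₑ ≤ ENNReal.ofReal √B * ENNReal.ofReal √(Q k (e.symm y)) := by
    intro k y hy
    rw [← inner_gradient_sub_gradient hconf hφ (hψ k) p (hKt hy), ← ofReal_norm,
      Real.norm_eq_abs, ← ENNReal.ofReal_mul (Real.sqrt_nonneg _)]
    refine ENNReal.ofReal_le_ofReal ?_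
    have hBy := (le_abs_self _).trans (hB y hy)
    rw [← Real.sqrt_mul ((normSq_nonneg h₂ _ _).trans hBy), mul_comm]
    refine Real.abs_le_sqrt ((sq_inner_le h₂ _ _ _).trans ?_)
    exact mul_le_mul_of_nonneg_left hBy (hQ0 k _)
  have hup : ∀ k, ∫⁻ y in K, ‖ν (e.symm y) ^ 2 * fderiv ℝ (φ ∘ e.symm) y v -
      fderiv ℝ (ψ k ∘ e.symm) y v‖ₑ ≤
      ENNReal.ofReal √B * (C * ((∫⁻ x, ENNReal.ofReal (Q k x) ∂μ) ^ (1 / 2 : ℝ) *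
        μ univ ^ (1 / 2 : ℝ))) := by
    intro k
    have hS : Measurable fun x => ENNReal.ofReal √(Q k x) :=
      (Real.continuous_sqrt.measurable.comp (hQm k)).ennreal_ofReal
    calc _ ≤ ∫⁻ y in K, ENNReal.ofReal √B * ENNReal.ofReal √(Q k (e.symm y)) :=
          setLIntegral_mono' hK.measurableSet (hpt k)
      _ = ENNReal.ofReal √B * ∫⁻ y in K, ENNReal.ofReal √(Q k (e.symm y)) :=
          lintegral_const_mul' _ _ ENNReal.ofReal_ne_top
      _ ≤ ENNReal.ofReal √B * (C * ∫⁻ x, ENNReal.ofReal √(Q k x) ∂μ) := by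
          gcongr
          exact hC _ hS
      _ ≤ _ := by
          gcongr
          have h1 := ENNReal.lintegral_mul_le_Lp_mul_Lq μ Real.HolderConjugate.two_two
            hS.aemeasurable (g := 1) aemeasurable_const
          simp only [Pi.mul_apply, Pi.one_apply, mul_one, ENNReal.one_rpow, lintegral_one] at h1
          refine h1.trans (le_of_eq ?_)
          congr 2
          refine lintegral_congr fun x => ?_
          rw [ENNReal.rpow_two, ← ENNReal.ofReal_pow (Real.sqrt_nonneg _), Real.sq_sqrt (hQ0 k x)]
  refine tendsto_of_tendsto_of_tendsto_of_le_of_le tendsto_const_nhds ?_ (fun k => zero_le) hup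
  have h3 := ((ENNReal.continuous_rpow_const (y := (1 / 2 : ℝ))).tendsto 0).comp hlim
  rw [ENNReal.zero_rpow_of_pos (by norm_num)] at h3
  have hμt : μ univ ^ (1 / 2 : ℝ) ≠ ⊤ :=
    ENNReal.rpow_ne_top_of_nonneg (by norm_num) (measure_ne_top _ _)
  have h4 := ENNReal.Tendsto.const_mul (ENNReal.Tendsto.const_mul
    (ENNReal.Tendsto.mul_const h3 (Or.inr hμt)) (Or.inr hCtop))
    (Or.inr (ENNReal.ofReal_ne_top (r := √B)))
  simp only [zero_mul, mul_zero] at h4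
  exact h4

end

/-! ### The conformal factor -/

section
variable {n : ℕ} {M : Type*} [TopologicalSpace M] [ChartedSpace (EuclideanSpace ℝ (Fin n)) M]
  [IsManifold (𝓡 n) ∞ M]

/-- In positive dimension the square of the conformal factor is smooth, as a quotient of two
coefficients of the metrics. -/
theorem contDiffOn_conformalFactor_sq [NeZero n] {h₁ h₂ : SmoothMetric n M} {ν : M → ℝ}
    (hconf : ∀ (x : M) (v w : TangentSpace (𝓡 n) x), h₂.inner x v w = ν x ^ 2 * h₁.inner x v w)
    (p : M) :
    ContDiffOn ℝ ∞ (fun y => ν ((chartAt (EuclideanSpace ℝ (Fin n)) p).symm y) ^ 2)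
      (chartAt (EuclideanSpace ℝ (Fin n)) p).target := by
  have hpos : ∀ y ∈ (chartAt (EuclideanSpace ℝ (Fin n)) p).target,
      chartGram h₁ (chartAt (EuclideanSpace ℝ (Fin n)) p) y 0 0 ≠ 0 := fun y hy =>
    (h₁.pos _ _ (coordVec_ne_zero p hy (by simp))).ne'
  refine ((contDiffOn_chartGram h₂ p 0 0).div (contDiffOn_chartGram h₁ p 0 0) hpos).congr
    fun y hy => ?_
  rw [Pi.div_apply, eq_div_iff (hpos y hy), chartGram_apply, chartGram_apply, hconf]

/-- A nonconstant conformal factor has a point where a partial derivative of its square, in the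
preferred chart at this point, does not vanish. -/
theorem exists_fderiv_conformalFactor_sq_ne_zero [ConnectedSpace M] {h₁ h₂ : SmoothMetric n M}
    {ν : M → ℝ} (hν : ∀ x, 0 < ν x) (hν_nonconst : ¬ ∃ c : ℝ, ∀ x, ν x = c)
    (hconf : ∀ (x : M) (v w : TangentSpace (𝓡 n) x), h₂.inner x v w = ν x ^ 2 * h₁.inner x v w) :
    ∃ (p : M) (i : Fin n),
      fderiv ℝ (fun y => ν ((chartAt (EuclideanSpace ℝ (Fin n)) p).symm y) ^ 2)
        (chartAt (EuclideanSpace ℝ (Fin n)) p p) (EuclideanSpace.single i 1) ≠ 0 := by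
  by_contra! hcon
  have hloc : IsLocallyConstant fun x => ν x ^ 2 := by
    -- in dimension zero nothing is known about `ν`, but the manifold is discrete
    rcases Nat.eq_zero_or_pos n with rfl | hn
    · have : DiscreteTopology M := ChartedSpace.discreteTopology (EuclideanSpace ℝ (Fin 0)) M
      exact IsLocallyConstant.of_discrete _
    have : NeZero n := ⟨hn.ne'⟩
    rw [IsLocallyConstant.iff_eventually_eq]
    intro p
    set e := chartAt (EuclideanSpace ℝ (Fin n)) p with he
    have hp : p ∈ e.source := mem_chart_source _ p
    obtain ⟨r, hr, hrt⟩ := Metric.isOpen_iff.1 e.open_target (e p) (e.map_source hp)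
    have hder : ∀ y ∈ Metric.ball (e p) r, fderiv ℝ (fun y => ν (e.symm y) ^ 2) y = 0 := by
      intro y hy
      set x := e.symm y with hx
      set e' := chartAt (EuclideanSpace ℝ (Fin n)) x with he'
      have hxe : x ∈ e'.source := mem_chart_source _ x
      have h0 : fderiv ℝ (fun z => ν (e'.symm z) ^ 2) (e' x) = 0 := by
        refine ContinuousLinearMap.coe_injective
          ((EuclideanSpace.basisFun (Fin n) ℝ).toBasis.ext fun i => ?_)
        simpa using hcon x i
      have h1 : (fun y => ν (e.symm y) ^ 2) =ᶠ[𝓝 y]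
          (fun z => ν (e'.symm z) ^ 2) ∘ (e' ∘ e.symm) := by
        filter_upwards [(e.continuousAt_symm (hrt hy)).eventually (e'.open_source.mem_nhds hxe)]
          with z hz
        simp [e'.left_inv hz]
      have h2 : DifferentiableAt ℝ (e' ∘ e.symm) y :=
        mdifferentiableAt_iff_differentiableAt.1
          ((mdifferentiableAt_chart x hxe).comp y (mdifferentiableAt_chart_symm p (hrt hy)))
      have h3 : DifferentiableAt ℝ (fun z => ν (e'.symm z) ^ 2) ((e' ∘ e.symm) y) :=
        ((contDiffOn_conformalFactor_sq hconf x).contDiffAt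
          (e'.open_target.mem_nhds (e'.map_source hxe))).differentiableAt (by simp)
      rw [h1.fderiv_eq, fderiv_comp y h3 h2]
      have h4 : (e' ∘ e.symm) y = e' x := rfl
      rw [h4, h0, ContinuousLinearMap.zero_comp]
    have hconst : ∀ y ∈ Metric.ball (e p) r, ν (e.symm y) ^ 2 = ν (e.symm (e p)) ^ 2 :=
      fun y hy => Metric.isOpen_ball.is_const_of_fderiv_eq_zero (f := fun y => ν (e.symm y) ^ 2)
        (convex_ball _ _).isPreconnected
        (((contDiffOn_conformalFactor_sq hconf p).differentiableOn (by simp)).mono hrt)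
        hder hy (Metric.mem_ball_self hr)
    filter_upwards [e.open_source.mem_nhds hp,
      e.continuousAt hp (Metric.ball_mem_nhds _ hr)] with x hx hxb
    have := hconst (e x) hxb
    rwa [e.left_inv hx, e.left_inv hp] at this
  obtain ⟨x₀⟩ : Nonempty M := inferInstance
  refine hν_nonconst ⟨ν x₀, fun x => ?_⟩
  have := hloc.apply_eq_of_isPreconnected isPreconnected_univ (mem_univ x) (mem_univ x₀)
  exact (sq_eq_sq₀ (hν x).le (hν x₀).le).1 this

end

/-! ### Closed covectors in Euclidean space -/

section
variable {E : Type*} [NormedAddCommGroup E] [NormedSpace ℝ E] [FiniteDimensional ℝ E]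
  [MeasurableSpace E] [BorelSpace E] {μ : Measure E}

theorem integrable_mul_of_tsupport_subset [IsFiniteMeasureOnCompacts μ] {U : Set E}
    (hU : IsOpen U) {F G : E → ℝ} (hF : ContinuousOn F U) (hG : Continuous G)
    (hc : HasCompactSupport G) (hs : tsupport G ⊆ U) : Integrable (fun y => F y * G y) μ := by
  refine Continuous.integrable_of_hasCompactSupport ?_ hc.mul_left
  refine continuous_of_tsupport fun y hy => ?_
  exact (hF.continuousAt (hU.mem_nhds (hs (tsupport_mul_subset_right hy)))).mul hG.continuousAt

/-- The integral of a component of `df ∧ dχ` vanishes for a compactly supported `χ`. -/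
theorem integral_fderiv_wedge_eq_zero [μ.IsAddHaarMeasure] {U : Set E} (hU : IsOpen U)
    {f χ : E → ℝ} (hf : ContDiffOn ℝ ∞ f U) (hχ : ContDiff ℝ ∞ χ) (hc : HasCompactSupport χ)
    (hs : tsupport χ ⊆ U) (a b : E) :
    Integrable (fun y => fderiv ℝ f y a * fderiv ℝ χ y b - fderiv ℝ f y b * fderiv ℝ χ y a) μ ∧
      ∫ y, (fderiv ℝ f y a * fderiv ℝ χ y b - fderiv ℝ f y b * fderiv ℝ χ y a) ∂μ = 0 := by
  have hdχ : ∀ b, ContDiff ℝ ∞ fun y => fderiv ℝ χ y b := fun b =>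
    (hχ.fderiv_right (m := ∞) (by simp)).clm_apply contDiff_const
  have hdf : ∀ a, ContinuousOn (fun y => fderiv ℝ f y a) U := fun a =>
    (hf.continuousOn_fderiv_of_isOpen hU (by simp)).clm_apply continuousOn_const
  have hcb : ∀ b, HasCompactSupport fun y => fderiv ℝ χ y b := fun b => hc.fderiv_apply ℝ b
  have hsb : ∀ b, tsupport (fun y => fderiv ℝ χ y b) ⊆ U := fun b =>
    (tsupport_fderiv_apply_subset ℝ b).trans hs
  have hint : ∀ a b, Integrable (fun y => fderiv ℝ f y a * fderiv ℝ χ y b) μ := fun a b =>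
    integrable_mul_of_tsupport_subset hU (hdf a) (hdχ b).continuous (hcb b) (hsb b)
  have hparts : ∀ a b, ∫ y, f y * fderiv ℝ (fun z => fderiv ℝ χ z b) y a ∂μ =
      -∫ y, fderiv ℝ f y a * fderiv ℝ χ y b ∂μ := by
    intro a b
    refine integral_mul_fderiv_eq_neg_fderiv_mul_of_integrable (hint a b) ?_ ?_ ?_ ?_
    · exact integrable_mul_of_tsupport_subset hU hf.continuousOn
        (((hdχ b).continuous_fderiv (by simp)).clm_apply continuous_const)
        ((hcb b).fderiv_apply ℝ a) ((tsupport_fderiv_apply_subset ℝ a).trans (hsb b))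
    · exact integrable_mul_of_tsupport_subset hU hf.continuousOn (hdχ b).continuous (hcb b) (hsb b)
    · exact fun y hy => (hf.contDiffAt (hU.mem_nhds (hsb b hy))).differentiableAt (by simp)
    · exact fun y _ => ((hdχ b).differentiable (by simp)) y
  refine ⟨(hint a b).sub (hint b a), ?_⟩
  rw [integral_sub (hint a b) (hint b a), ← neg_inj, neg_sub, neg_zero]
  have hsymm : ∀ y, fderiv ℝ (fun z => fderiv ℝ χ z b) y a =
      fderiv ℝ (fun z => fderiv ℝ χ z a) y b := by
    intro y
    have hd : DifferentiableAt ℝ (fderiv ℝ χ) y :=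
      ((hχ.fderiv_right (m := ∞) (by simp)).differentiable (by simp)) y
    rw [fderiv_clm_apply hd (differentiableAt_const _),
      fderiv_clm_apply hd (differentiableAt_const _)]
    have h2 : (2 : ℕ∞ω) ≤ ((⊤ : ℕ∞) : ℕ∞ω) := WithTop.coe_le_coe.2 le_top
    simpa using (hχ.contDiffAt.isSymmSndFDerivAt (by simpa using h2)).eq a b
  have h1 := hparts a b
  have h2 := hparts b a
  simp only [hsymm] at h1
  linarith

/-- The integral of a bump function times a function of constant sign does not vanish. The sign is
that of the constant `c`. -/
theorem setIntegral_bump_mul_ne_zero [μ.IsOpenPosMeasure] [IsFiniteMeasureOnCompacts μ] {y₀ : E}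
    (b : ContDiffBump y₀) {F : E → ℝ} {c : ℝ}
    (hF : ContinuousOn F (Metric.closedBall y₀ b.rOut))
    (hpos : ∀ y ∈ Metric.closedBall y₀ b.rOut, 0 < F y * c) :
    ∫ y in Metric.closedBall y₀ b.rOut, b y * F y ∂μ ≠ 0 := by
  intro h0
  have hcont : ContinuousOn (fun y => b y * (F y * c)) (Metric.closedBall y₀ b.rOut) :=
    b.continuous.continuousOn.mul (hF.mul continuousOn_const)
  have hint := hcont.integrableOn_compact (μ := μ) (isCompact_closedBall _ _)
  have h1 : ∫ y in Metric.closedBall y₀ b.rOut, b y * (F y * c) ∂μ = 0 := by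
    simp only [← mul_assoc]
    rw [integral_mul_const, h0, zero_mul]
  have h2 : 0 < ∫ y in Metric.closedBall y₀ b.rOut, b y * (F y * c) ∂μ := by
    rw [setIntegral_pos_iff_support_of_nonneg_ae _ hint]
    · refine (Metric.measure_ball_pos μ y₀ b.rOut_pos).trans_le (measure_mono fun y hy => ?_)
      have hy' := Metric.ball_subset_closedBall hy
      exact ⟨(mul_pos (b.pos_of_mem_ball hy) (hpos y hy')).ne', hy'⟩
    · filter_upwards [ae_restrict_mem Metric.isClosed_closedBall.measurableSet] with y hy
      exact mul_nonneg b.nonneg (hpos y hy).le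
  exact h2.ne' h1

theorem tendsto_setIntegral_mul_of_lintegral_enorm {K : Set E} (hK : IsCompact K)
    {θ : ℕ → E → ℝ} {G : E → ℝ} (hG : Continuous G)
    (hlim : Filter.Tendsto (fun k => ∫⁻ y in K, ‖θ k y‖ₑ ∂μ) Filter.atTop (𝓝 0)) :
    Filter.Tendsto (fun k => ∫ y in K, θ k y * G y ∂μ) Filter.atTop (𝓝 0) := by
  obtain ⟨B, hB⟩ := hK.exists_bound_of_continuousOn hG.continuousOn
  rw [tendsto_zero_iff_enorm_tendsto_zero]
  have h1 := ENNReal.Tendsto.mul_const hlim (Or.inr (ENNReal.ofReal_ne_top (r := B)))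
  rw [zero_mul] at h1
  refine tendsto_of_tendsto_of_tendsto_of_le_of_le tendsto_const_nhds h1 (fun k => zero_le)
    fun k => ?_
  refine (enorm_integral_le_lintegral_enorm _).trans ?_
  rw [← lintegral_mul_const' _ _ ENNReal.ofReal_ne_top]
  refine setLIntegral_mono' hK.measurableSet fun y hy => ?_
  rw [enorm_mul]
  gcongr
  rw [← ofReal_norm]
  exact ENNReal.ofReal_le_ofReal (hB y hy)

end

/-- In dimension at least two, `w db` is not a limit of exact covectors near a point where `w` has a
nonzero partial derivative, if `b` is a bump at this point. Otherwise the wedge product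
`dw ∧ db` would integrate to zero against every function; it is tested with the differential of a
second coordinate, cut off. -/
theorem false_of_tendsto_of_ne {n : ℕ} {U : Set (EuclideanSpace ℝ (Fin n))} (hU : IsOpen U)
    {y₀ : EuclideanSpace ℝ (Fin n)} {w : EuclideanSpace ℝ (Fin n) → ℝ} (hw : ContDiffOn ℝ ∞ w U)
    (b β : ContDiffBump y₀) (hbβ : b.rOut = β.rIn) (hβU : Metric.closedBall y₀ β.rOut ⊆ U)
    {i j : Fin n} (hij : i ≠ j) {c : ℝ}
    (hpos : ∀ y ∈ Metric.closedBall y₀ β.rOut,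
      0 < fderiv ℝ w y (EuclideanSpace.single i 1) * c)
    {ψ : ℕ → EuclideanSpace ℝ (Fin n) → ℝ} (hψ : ∀ k, ContDiffOn ℝ ∞ (ψ k) U)
    (hlim : ∀ v, Filter.Tendsto (fun k => ∫⁻ y in Metric.closedBall y₀ β.rOut,
      ‖w y * fderiv ℝ b y v - fderiv ℝ (ψ k) y v‖ₑ) Filter.atTop (𝓝 0)) : False := by
  set K := Metric.closedBall y₀ β.rOut with hKdef
  have hK : IsCompact K := isCompact_closedBall _ _
  set ei : EuclideanSpace ℝ (Fin n) := EuclideanSpace.single i 1 with hei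
  set ej : EuclideanSpace ℝ (Fin n) := EuclideanSpace.single j 1 with hej
  have hsub : Metric.closedBall y₀ b.rOut ⊆ K :=
    Metric.closedBall_subset_closedBall (hbβ.trans_le β.rIn_lt_rOut.le)
  let coord : EuclideanSpace ℝ (Fin n) →L[ℝ] ℝ := EuclideanSpace.proj j
  set χ : EuclideanSpace ℝ (Fin n) → ℝ := fun y => coord y * β y with hχdef
  have hχ : ContDiff ℝ ∞ χ := coord.contDiff.mul β.contDiff
  have hχc : HasCompactSupport χ := β.hasCompactSupport.mul_left
  have hχs : tsupport χ ⊆ K := (tsupport_mul_subset_right).trans_eq β.tsupport_eq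
  have hdχ : ∀ v, Continuous fun y => fderiv ℝ χ y v := fun v =>
    (hχ.continuous_fderiv (by simp)).clm_apply continuous_const
  -- on the support of `b` the cutoff is `1`, so `dχ` is the differential of the coordinate
  have hχb : ∀ y ∈ Metric.ball y₀ b.rOut, fderiv ℝ χ y = coord := by
    intro y hy
    have : χ =ᶠ[𝓝 y] coord := by
      filter_upwards [β.eventuallyEq_one_of_mem_ball (hbβ ▸ hy)] with z hz
      simp [hχdef, hz]
    rw [this.fderiv_eq, coord.fderiv]
  set f : ℕ → EuclideanSpace ℝ (Fin n) → ℝ := fun k y => w y * b y - ψ k y with hfdef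
  have hf : ∀ k, ContDiffOn ℝ ∞ (f k) U := fun k => (hw.mul b.contDiff.contDiffOn).sub (hψ k)
  have hθ : ∀ k, ∀ y ∈ K, ∀ v, w y * fderiv ℝ b y v - fderiv ℝ (ψ k) y v =
      fderiv ℝ (f k) y v - b y * fderiv ℝ w y v := by
    intro k y hy v
    have hwd : DifferentiableAt ℝ w y :=
      (hw.contDiffAt (hU.mem_nhds (hβU hy))).differentiableAt (by simp)
    have hψd : DifferentiableAt ℝ (ψ k) y :=
      ((hψ k).contDiffAt (hU.mem_nhds (hβU hy))).differentiableAt (by simp)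
    have hbd : DifferentiableAt ℝ b y := (b.contDiff (n := 1)).differentiable (by simp) y
    simp only [hfdef]
    rw [fderiv_fun_sub (hwd.fun_mul hbd) hψd, fderiv_fun_mul hwd hbd]
    simp only [_root_.sub_apply, _root_.add_apply, _root_.smul_apply, smul_eq_mul]
    ring
  have hwedge : ∀ k, ∀ y ∈ K,
      (w y * fderiv ℝ b y ei - fderiv ℝ (ψ k) y ei) * fderiv ℝ χ y ej -
        (w y * fderiv ℝ b y ej - fderiv ℝ (ψ k) y ej) * fderiv ℝ χ y ei =
      (fderiv ℝ (f k) y ei * fderiv ℝ χ y ej - fderiv ℝ (f k) y ej * fderiv ℝ χ y ei) -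
        b y * fderiv ℝ w y ei := by
    intro k y hy
    rw [hθ k y hy, hθ k y hy]
    by_cases hyb : y ∈ Metric.ball y₀ b.rOut
    · rw [hχb y hyb]
      have h1 : coord ei = 0 := by simp [coord, hei, hij.symm]
      have h2 : coord ej = 1 := by simp [coord, hej]
      rw [h1, h2]
      ring
    · have : b y = 0 := by
        by_contra hne
        exact hyb (b.support_eq ▸ hne)
      rw [this]
      ring
  have hθc : ∀ k v, ContinuousOn
      (fun y => w y * fderiv ℝ b y v - fderiv ℝ (ψ k) y v) K := by
    intro k v
    refine (hw.continuousOn.mono hβU).mul (Continuous.continuousOn ?_) |>.sub ?_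
    · exact ((b.contDiff (n := 1)).continuous_fderiv (by simp)).clm_apply continuous_const
    · exact (((hψ k).continuousOn_fderiv_of_isOpen hU (by simp)).clm_apply
        continuousOn_const).mono hβU
  have hint1 : ∀ k v v', IntegrableOn
      (fun y => (w y * fderiv ℝ b y v - fderiv ℝ (ψ k) y v) * fderiv ℝ χ y v') K := fun k v v' =>
    ((hθc k v).mul (hdχ v').continuousOn).integrableOn_compact hK
  have hdw : ContinuousOn (fun y => fderiv ℝ w y ei) K :=
    ((hw.continuousOn_fderiv_of_isOpen hU (by simp)).clm_apply continuousOn_const).mono hβU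
  have hint2 : IntegrableOn (fun y => b y * fderiv ℝ w y ei) K :=
    (b.continuous.continuousOn.mul hdw).integrableOn_compact hK
  have hT := (tendsto_setIntegral_mul_of_lintegral_enorm hK (hdχ ej) (hlim ei)).sub
    (tendsto_setIntegral_mul_of_lintegral_enorm hK (hdχ ei) (hlim ej))
  have hval : ∀ k,
      (∫ y in K, (w y * fderiv ℝ b y ei - fderiv ℝ (ψ k) y ei) * fderiv ℝ χ y ej) -
        (∫ y in K, (w y * fderiv ℝ b y ej - fderiv ℝ (ψ k) y ej) * fderiv ℝ χ y ei) =
      -∫ y in K, b y * fderiv ℝ w y ei := by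
    intro k
    obtain ⟨hI, h0⟩ := integral_fderiv_wedge_eq_zero (μ := volume) hU (hf k) hχ hχc
      (hχs.trans hβU) ei ej
    rw [← integral_sub (hint1 k ei ej) (hint1 k ej ei),
      setIntegral_congr_fun hK.measurableSet (hwedge k), integral_sub hI.integrableOn hint2,
      setIntegral_eq_integral_of_forall_compl_eq_zero, h0, zero_sub]
    intro y hy
    have h1 : fderiv ℝ χ y = 0 := by
      by_contra hne
      exact hy (hχs (support_fderiv_subset ℝ hne))
    simp [h1]
  simp only [hval, sub_zero] at hT
  have hzero : ∫ y in K, b y * fderiv ℝ w y ei = 0 := by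
    have := tendsto_nhds_unique hT tendsto_const_nhds
    linarith
  refine setIntegral_bump_mul_ne_zero (μ := volume) b (hdw.mono hsub)
    (fun y hy => hpos y (hsub hy)) ?_
  rw [← hzero]
  refine (setIntegral_eq_of_subset_of_forall_sdiff_eq_zero hK.measurableSet hsub
    fun y hy => ?_).symm
  have : b y = 0 := by
    by_contra hne
    exact hy.2 (Metric.ball_subset_closedBall (b.support_eq ▸ hne))
  rw [this, zero_mul]

/-! ### Integration along segments in dimension one -/

/-- The identification of `ℝ` with the one-dimensional Euclidean space. -/
noncomputable def line : ℝ ≃ₗᵢ[ℝ] EuclideanSpace ℝ (Fin 1) where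
  toFun t := EuclideanSpace.single 0 t
  invFun y := y 0
  map_add' s t := by ext i; fin_cases i; simp
  map_smul' c t := by ext i; fin_cases i; simp
  left_inv t := by simp
  right_inv y := by ext i; fin_cases i; simp
  norm_map' t := by simp

theorem setLIntegral_comp_line (S : Set ℝ) (g : EuclideanSpace ℝ (Fin 1) → ℝ≥0∞) :
    ∫⁻ r in S, g (line r) = ∫⁻ y in line '' S, g y :=
  line.measurePreserving.setLIntegral_comp_emb line.toMeasurableEquiv.measurableEmbedding g S

theorem line_image_Icc (t₀ r : ℝ) :
    line '' Icc (t₀ - r) (t₀ + r) = Metric.closedBall (line t₀) r := by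
  rw [← Real.closedBall_eq_Icc, line.image_closedBall]

theorem hasDerivAt_comp_line {f : EuclideanSpace ℝ (Fin 1) → ℝ} {r : ℝ}
    (hf : DifferentiableAt ℝ f (line r)) :
    HasDerivAt (fun r => f (line r)) (fderiv ℝ f (line r) (line 1)) r :=
  hf.hasFDerivAt.comp_hasDerivAt r line.toContinuousLinearEquiv.hasFDerivAt.hasDerivAt

section
variable {U : Set (EuclideanSpace ℝ (Fin 1))}

theorem continuousOn_fderiv_comp_line (hU : IsOpen U) {f : EuclideanSpace ℝ (Fin 1) → ℝ}
    (hf : ContDiffOn ℝ ∞ f U) {S : Set ℝ} (hS : line '' S ⊆ U) :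
    ContinuousOn (fun r => fderiv ℝ f (line r) (line 1)) S :=
  ((hf.continuousOn_fderiv_of_isOpen hU (by simp)).clm_apply continuousOn_const).comp
    line.continuous.continuousOn fun r hr => hS ⟨r, hr, rfl⟩

theorem integral_fderiv_comp_line (hU : IsOpen U) {f : EuclideanSpace ℝ (Fin 1) → ℝ}
    (hf : ContDiffOn ℝ ∞ f U)
    {s t : ℝ} (hst : line '' uIcc s t ⊆ U) :
    ∫ r in s..t, fderiv ℝ f (line r) (line 1) = f (line t) - f (line s) :=
  intervalIntegral.integral_eq_sub_of_hasDerivAt (f := fun r => f (line r))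
    (fun r hr => hasDerivAt_comp_line
      ((hf.contDiffAt (hU.mem_nhds (hst ⟨r, hr, rfl⟩))).differentiableAt (by simp)))
    (continuousOn_fderiv_comp_line hU hf hst).intervalIntegrable

/-- If exact covectors approximate `w dφ` in the mean on a segment, then the increments of their
primitives converge to the integral of `w dφ`. -/
theorem tendsto_sub_of_tendsto_lintegral (hU : IsOpen U) {w φ : EuclideanSpace ℝ (Fin 1) → ℝ}
    (hw : ContinuousOn w U) (hφ : ContDiffOn ℝ ∞ φ U)
    {ψ : ℕ → EuclideanSpace ℝ (Fin 1) → ℝ} (hψ : ∀ k, ContDiffOn ℝ ∞ (ψ k) U) {s t : ℝ}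
    (hst : line '' uIcc s t ⊆ U)
    (hlim : Filter.Tendsto (fun k => ∫⁻ y in line '' uIcc s t,
      ‖w y * fderiv ℝ φ y (line 1) - fderiv ℝ (ψ k) y (line 1)‖ₑ) Filter.atTop (𝓝 0)) :
    Filter.Tendsto (fun k => ψ k (line t) - ψ k (line s)) Filter.atTop
      (𝓝 (∫ r in s..t, w (line r) * fderiv ℝ φ (line r) (line 1))) := by
  have hI : IntervalIntegrable (fun r => w (line r) * fderiv ℝ φ (line r) (line 1)) volume s t :=
    ((hw.comp line.continuous.continuousOn fun r hr => hst ⟨r, hr, rfl⟩).mul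
      (continuousOn_fderiv_comp_line hU hφ hst)).intervalIntegrable
  have hIψ : ∀ k, IntervalIntegrable (fun r => fderiv ℝ (ψ k) (line r) (line 1)) volume s t :=
    fun k => (continuousOn_fderiv_comp_line hU (hψ k) hst).intervalIntegrable
  rw [← tendsto_sub_nhds_zero_iff, tendsto_zero_iff_enorm_tendsto_zero]
  refine tendsto_of_tendsto_of_tendsto_of_le_of_le tendsto_const_nhds hlim (fun k => zero_le)
    fun k => ?_
  rw [← integral_fderiv_comp_line hU (hψ k) hst, ← intervalIntegral.integral_sub (hIψ k) hI,
    ← setLIntegral_comp_line (uIcc s t)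
      (fun y => ‖w y * fderiv ℝ φ y (line 1) - fderiv ℝ (ψ k) y (line 1)‖ₑ),
    ← ofReal_norm, intervalIntegral.norm_intervalIntegral_eq, ofReal_norm]
  refine (enorm_integral_le_lintegral_enorm _).trans ?_
  refine (lintegral_mono_set uIoc_subset_uIcc).trans (le_of_eq ?_)
  refine lintegral_congr fun r => ?_
  rw [← enorm_neg, neg_sub]

/-- The integral of `w db` across the support of a bump `b` does not vanish where `w` is strictly
monotone: it is the opposite of the integral of `b dw`. -/
theorem integral_mul_fderiv_bump_ne_zero (hU : IsOpen U) {t₀ r : ℝ}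
    {w : EuclideanSpace ℝ (Fin 1) → ℝ}
    (hw : ContDiffOn ℝ ∞ w U) (b : ContDiffBump (line t₀)) (hb : b.rOut ≤ r)
    (hr : Metric.closedBall (line t₀) r ⊆ U) {c : ℝ}
    (hpos : ∀ y ∈ Metric.closedBall (line t₀) r, 0 < fderiv ℝ w y (line 1) * c) :
    ∫ s in (t₀ - r)..(t₀ + r), w (line s) * fderiv ℝ b (line s) (line 1) ≠ 0 := by
  have hr0 : 0 < r := b.rOut_pos.trans_le hb
  have hle : t₀ - r ≤ t₀ + r := by linarith
  have hst : line '' uIcc (t₀ - r) (t₀ + r) ⊆ U := by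
    rw [uIcc_of_le hle, line_image_Icc]
    exact hr
  have hbU : ContDiffOn ℝ ∞ b U := b.contDiff.contDiffOn
  have hparts := intervalIntegral.integral_mul_deriv_eq_deriv_mul
    (u := fun s => w (line s)) (v := fun s => b (line s))
    (fun s hs => hasDerivAt_comp_line
      ((hw.contDiffAt (hU.mem_nhds (hst ⟨s, hs, rfl⟩))).differentiableAt (by simp)))
    (fun s hs => hasDerivAt_comp_line
      ((hbU.contDiffAt (hU.mem_nhds (hst ⟨s, hs, rfl⟩))).differentiableAt (by simp)))
    (continuousOn_fderiv_comp_line hU hw hst).intervalIntegrable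
    (continuousOn_fderiv_comp_line hU hbU hst).intervalIntegrable
  have hend : ∀ s, |s - t₀| = r → b (line s) = 0 := by
    intro s hs
    refine b.zero_of_le_dist ?_
    rw [line.dist_map, Real.dist_eq, hs]
    exact hb
  have h1 : b (line (t₀ + r)) = 0 := hend _ (by rw [add_sub_cancel_left, abs_of_pos hr0])
  have h2 : b (line (t₀ - r)) = 0 := hend _ (by
    rw [show t₀ - r - t₀ = -r by ring, abs_neg, abs_of_pos hr0])
  rw [hparts, h1, h2, mul_zero, mul_zero, sub_zero, zero_sub, neg_ne_zero]
  intro h0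
  have hposint : 0 < ∫ s in (t₀ - r)..(t₀ + r),
      fderiv ℝ w (line s) (line 1) * b (line s) * c := by
    have hmem : ∀ s ∈ Icc (t₀ - r) (t₀ + r), line s ∈ Metric.closedBall (line t₀) r :=
      fun s hs => line_image_Icc t₀ r ▸ ⟨s, hs, rfl⟩
    refine intervalIntegral.integral_pos (by linarith) ?_ (fun s hs => ?_)
      ⟨t₀, ⟨by linarith, by linarith⟩, ?_⟩
    · have := continuousOn_fderiv_comp_line hU hw hst
      rw [uIcc_of_le hle] at this
      exact (this.mul (b.continuous.comp line.continuous).continuousOn).mul continuousOn_const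
    · have := (hpos _ (hmem s (Ioc_subset_Icc_self hs))).le
      rw [mul_right_comm]
      exact mul_nonneg this b.nonneg
    · have := hpos _ (hmem t₀ ⟨by linarith, by linarith⟩)
      rw [mul_right_comm]
      exact mul_pos this (b.pos_of_mem_ball (Metric.mem_ball_self b.rOut_pos))
  rw [intervalIntegral.integral_mul_const, h0, zero_mul] at hposint
  exact lt_irrefl _ hposint

end

/-! ### Gradients that are not limits of gradients for the conformal metric -/

section
variable {n : ℕ} {M : Type*} [TopologicalSpace M] [ChartedSpace (EuclideanSpace ℝ (Fin n)) M]
  [IsManifold (𝓡 n) ∞ M]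

/-- A smooth bump function on the manifold, together with its expression in the chart and a wider
cutoff in the chart. -/
theorem exists_bump [T2Space M] (p : M) {R : ℝ} (hR : 0 < R)
    (hball : Metric.closedBall (chartAt (EuclideanSpace ℝ (Fin n)) p p) R ⊆
      (chartAt (EuclideanSpace ℝ (Fin n)) p).target) :
    ∃ (φ : M → ℝ) (b β : ContDiffBump (chartAt (EuclideanSpace ℝ (Fin n)) p p)),
      ContMDiff (𝓡 n) 𝓘(ℝ, ℝ) ∞ φ ∧ b.rOut = β.rIn ∧ β.rOut = R ∧
      EqOn (φ ∘ (chartAt (EuclideanSpace ℝ (Fin n)) p).symm) b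
        (chartAt (EuclideanSpace ℝ (Fin n)) p).target ∧
      ∀ x ∉ (chartAt (EuclideanSpace ℝ (Fin n)) p).symm ''
        Metric.closedBall (chartAt (EuclideanSpace ℝ (Fin n)) p p) b.rOut, φ x = 0 := by
  set e := chartAt (EuclideanSpace ℝ (Fin n)) p with he
  let b : ContDiffBump (e p) := ⟨R / 4, R / 2, by positivity, by linarith⟩
  let β : ContDiffBump (e p) := ⟨R / 2, R, by positivity, by linarith⟩
  let f : SmoothBumpFunction (𝓡 n) p :=
    { toContDiffBump := (⟨R / 4, R / 2, by positivity, by linarith⟩ :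
        ContDiffBump (extChartAt (𝓡 n) p p))
      closedBall_subset := by
        simp only [mfld_simps, inter_univ]
        exact (Metric.closedBall_subset_closedBall (by linarith)).trans hball }
  have hfe : ∀ x ∈ e.source, f x = b (e x) := fun x hx => f.eqOn_source hx
  refine ⟨f, b, β, f.contMDiff, rfl, rfl, fun y hy => ?_, fun x hx => ?_⟩
  · simp only [Function.comp_apply]
    rw [hfe _ (e.map_target hy), e.right_inv hy]
  · by_contra hne
    have hxs : x ∈ e.source := f.support_subset_source hne
    rw [hfe x hxs] at hne
    have hxb : e x ∈ Metric.ball (e p) b.rOut := b.support_eq ▸ hne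
    exact hx ⟨e x, Metric.ball_subset_closedBall hxb, e.left_inv hxs⟩

/-- Where a continuous function does not vanish it has constant sign nearby. -/
theorem exists_closedBall_pos (p : M) {F : EuclideanSpace ℝ (Fin n) → ℝ}
    (hF : ContinuousOn F (chartAt (EuclideanSpace ℝ (Fin n)) p).target)
    (h0 : F (chartAt (EuclideanSpace ℝ (Fin n)) p p) ≠ 0) :
    ∃ R > 0, Metric.closedBall (chartAt (EuclideanSpace ℝ (Fin n)) p p) R ⊆
        (chartAt (EuclideanSpace ℝ (Fin n)) p).target ∧
      ∀ y ∈ Metric.closedBall (chartAt (EuclideanSpace ℝ (Fin n)) p p) R,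
        0 < F y * F (chartAt (EuclideanSpace ℝ (Fin n)) p p) := by
  set e := chartAt (EuclideanSpace ℝ (Fin n)) p with he
  have ht : e.target ∈ 𝓝 (e p) := e.open_target.mem_nhds (mem_chart_target _ p)
  have h1 : ∀ᶠ y in 𝓝 (e p), 0 < F y * F (e p) :=
    ((hF.continuousAt ht).mul continuousAt_const).eventually
      (lt_mem_nhds (mul_self_pos.2 h0))
  obtain ⟨R, hR, hsub⟩ := Metric.nhds_basis_closedBall.mem_iff.1 (Filter.inter_mem ht h1)
  exact ⟨R, hR, fun y hy => (hsub hy).1, fun y hy => (hsub hy).2⟩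

end

section
variable {M : Type*} [TopologicalSpace M] [ChartedSpace (EuclideanSpace ℝ (Fin 1)) M]
  [IsManifold (𝓡 1) ∞ M]

/-- The preferred chart of a one-dimensional manifold, with values in `ℝ`. -/
noncomputable def realChart (p : M) : OpenPartialHomeomorph M ℝ :=
  (chartAt (EuclideanSpace ℝ (Fin 1)) p).trans
    line.symm.toHomeomorph.toOpenPartialHomeomorph

theorem mem_realChart_source (p : M) : p ∈ (realChart p).source := by
  simp [realChart]

theorem mem_realChart_target {p : M} {t : ℝ} :
    t ∈ (realChart p).target ↔ line t ∈ (chartAt (EuclideanSpace ℝ (Fin 1)) p).target := by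
  simp only [realChart, OpenPartialHomeomorph.trans_target, mem_inter_iff, mem_preimage]
  exact ⟨fun h => h.2, fun h => ⟨mem_univ _, h⟩⟩

/-- If the differentials of `ψ k` approximate `w dφ` in the mean, then the increments of `ψ k`
between two points of a connected open set on which `φ` vanishes tend to zero. Having this property
is a transitive relation between points which holds for nearby points. -/
theorem tendsto_sub_of_isPreconnected {w φ : M → ℝ} {ψ : ℕ → M → ℝ} {V : Set M} (hVo : IsOpen V)
    (hV : IsPreconnected V) (hφ : ∀ x ∈ V, φ x = 0)
    (hφs : ContMDiff (𝓡 1) 𝓘(ℝ, ℝ) ∞ φ) (hψ : ∀ k, ContMDiff (𝓡 1) 𝓘(ℝ, ℝ) ∞ (ψ k))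
    (hw : ∀ p : M, ContinuousOn (fun y => w ((chartAt (EuclideanSpace ℝ (Fin 1)) p).symm y))
      (chartAt (EuclideanSpace ℝ (Fin 1)) p).target)
    (hlim : ∀ (p : M) (K : Set (EuclideanSpace ℝ (Fin 1))), IsCompact K →
      K ⊆ (chartAt (EuclideanSpace ℝ (Fin 1)) p).target →
      Filter.Tendsto (fun k => ∫⁻ y in K, ‖w ((chartAt (EuclideanSpace ℝ (Fin 1)) p).symm y) *
          fderiv ℝ (φ ∘ (chartAt (EuclideanSpace ℝ (Fin 1)) p).symm) y (line 1) -
        fderiv ℝ (ψ k ∘ (chartAt (EuclideanSpace ℝ (Fin 1)) p).symm) y (line 1)‖ₑ)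
        Filter.atTop (𝓝 0)) {a b : M} (ha : a ∈ V) (hb : b ∈ V) :
    Filter.Tendsto (fun k => ψ k b - ψ k a) Filter.atTop (𝓝 0) := by
  refine hV.induction₂ (fun x y => Filter.Tendsto (fun k => ψ k y - ψ k x) Filter.atTop (𝓝 0))
    (fun x hx => ?_) (fun x y z _ _ _ hxy hyz => ?_) (fun x y _ _ hxy => ?_) ha hb
  · set e := chartAt (EuclideanSpace ℝ (Fin 1)) x with he
    have hxs : x ∈ e.source := mem_chart_source _ x
    have hpre : e.target ∩ e.symm ⁻¹' V ∈ 𝓝 (e x) :=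
      (e.isOpen_inter_preimage_symm hVo).mem_nhds
        ⟨e.map_source hxs, by rwa [mem_preimage, e.left_inv hxs]⟩
    obtain ⟨r, hr, hball⟩ := Metric.nhds_basis_ball.mem_iff.1 hpre
    refine nhdsWithin_le_nhds ?_
    filter_upwards [e.open_source.mem_nhds hxs, e.continuousAt hxs (Metric.ball_mem_nhds _ hr)]
      with z hzs hzb
    obtain ⟨s, hs⟩ := line.surjective (e x)
    obtain ⟨t, ht⟩ := line.surjective (e z)
    have hst : line '' uIcc s t ⊆ Metric.ball (e x) r := by
      rw [← segment_eq_uIcc]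
      have := image_segment ℝ (line.toLinearEquiv.toLinearMap.toAffineMap) s t
      refine (this.trans_subset ((convex_ball (e x) r).segment_subset ?_ ?_))
      · exact (show line s ∈ Metric.ball (e x) r from hs ▸ Metric.mem_ball_self hr)
      · exact (show line t ∈ Metric.ball (e x) r from ht ▸ hzb)
    have hst' : line '' uIcc s t ⊆ e.target := hst.trans fun y hy => (hball hy).1
    have hK : IsCompact (line '' uIcc s t) := isCompact_uIcc.image line.continuous
    have h1 := tendsto_sub_of_tendsto_lintegral e.open_target (hw x)
      (contDiffOn_comp_chart_symm hφs x) (fun k => contDiffOn_comp_chart_symm (hψ k) x) hst'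
      (hlim x _ hK hst')
    have h2 : ∫ r in s..t, w (e.symm (line r)) *
        fderiv ℝ (φ ∘ e.symm) (line r) (line 1) = 0 := by
      rw [← intervalIntegral.integral_zero (μ := volume) (a := s) (b := t) (E := ℝ)]
      refine intervalIntegral.integral_congr fun q hq => ?_
      have h3 : φ ∘ e.symm =ᶠ[𝓝 (line q)] fun _ => 0 := by
        filter_upwards [Metric.isOpen_ball.mem_nhds (hst ⟨q, hq, rfl⟩)] with y hy
        exact hφ _ (hball hy).2
      rw [h3.fderiv_eq]
      simp
    simp only [← he] at h1
    rw [h2] at h1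
    simpa [hs, ht, e.left_inv hxs, e.left_inv hzs] using h1
  · have := hxy.add hyz
    rw [add_zero] at this
    exact this.congr fun k => by ring
  · have := hxy.neg
    rw [neg_zero] at this
    exact this.congr fun k => by ring

end

section
variable {n : ℕ} {M : Type*} [TopologicalSpace M] [ChartedSpace (EuclideanSpace ℝ (Fin n)) M]
  [IsManifold (𝓡 n) ∞ M] [MeasurableSpace M] [BorelSpace M] [SecondCountableTopology M]
  [T2Space M] [CompactSpace M] [ConnectedSpace M]

/-- In dimension at least two the obstruction is local: near a point with `d(ν²) ≠ 0` the covector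
field `ν² dφ` is not a limit of closed ones. -/
theorem exists_not_tendsto_of_ne_one (hn : n ≠ 1) {h₁ h₂ : SmoothMetric n M} {ν : M → ℝ}
    (hν : ∀ x, 0 < ν x) (hν_nonconst : ¬ ∃ c : ℝ, ∀ x, ν x = c)
    (hconf : ∀ (x : M) (v w : TangentSpace (𝓡 n) x), h₂.inner x v w = ν x ^ 2 * h₁.inner x v w) :
    ∃ φ : M → ℝ, ContMDiff (𝓡 n) 𝓘(ℝ, ℝ) ∞ φ ∧
      ∀ ψ : ℕ → M → ℝ, (∀ k, ContMDiff (𝓡 n) 𝓘(ℝ, ℝ) ∞ (ψ k)) →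
        ¬ Filter.Tendsto (fun k => ∫⁻ x, ENNReal.ofReal (h₂.inner x
          (gradient h₁ φ x - gradient h₂ (ψ k) x) (gradient h₁ φ x - gradient h₂ (ψ k) x))
            ∂(riemannianVolume h₁)) Filter.atTop (𝓝 0) := by
  obtain ⟨p, i, hi⟩ := exists_fderiv_conformalFactor_sq_ne_zero hν hν_nonconst hconf
  have : NeZero n := ⟨fun h => (h ▸ i).elim0⟩
  have : Nontrivial (Fin n) := Fin.nontrivial_iff_two_le.2 (by
    have := NeZero.ne n
    omega)
  obtain ⟨j, hij⟩ := exists_ne i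
  set e := chartAt (EuclideanSpace ℝ (Fin n)) p with he
  have hw := contDiffOn_conformalFactor_sq hconf p
  obtain ⟨R, hR, hball, hpos⟩ := exists_closedBall_pos p
    ((hw.continuousOn_fderiv_of_isOpen e.open_target (by simp)).clm_apply
      (continuousOn_const (c := EuclideanSpace.single i 1))) hi
  obtain ⟨φ, b, β, hφ, hbβ, rfl, hφb, -⟩ := exists_bump p hR hball
  refine ⟨φ, hφ, fun ψ hψ hlim => ?_⟩
  refine false_of_tendsto_of_ne e.open_target hw b β hbβ hball hij.symm hpos
    (fun k => contDiffOn_comp_chart_symm (hψ k) p) fun v => ?_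
  refine (tendsto_setLIntegral_enorm_sub hconf hφ hψ hlim p (isCompact_closedBall _ _) hball
    v).congr fun k => setLIntegral_congr_fun Metric.isClosed_closedBall.measurableSet fun y hy => ?_
  have : φ ∘ e.symm =ᶠ[𝓝 y] b := hφb.eventuallyEq_of_mem (e.open_target.mem_nhds (hball hy))
  rw [this.fderiv_eq]

end

section
variable {M : Type*} [TopologicalSpace M] [ChartedSpace (EuclideanSpace ℝ (Fin 1)) M]
  [IsManifold (𝓡 1) ∞ M] [MeasurableSpace M] [BorelSpace M] [SecondCountableTopology M]
  [T2Space M] [CompactSpace M] [ConnectedSpace M]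

/-- In dimension one the obstruction is global: primitives with differentials close to `ν² dφ`
change by a definite amount across the support of the bump `φ`, and by almost nothing along the rest
of the manifold, which is connected. -/
theorem exists_not_tendsto_of_one_dim {h₁ h₂ : SmoothMetric 1 M} {ν : M → ℝ}
    (hν : ∀ x, 0 < ν x) (hν_nonconst : ¬ ∃ c : ℝ, ∀ x, ν x = c)
    (hconf : ∀ (x : M) (v w : TangentSpace (𝓡 1) x), h₂.inner x v w = ν x ^ 2 * h₁.inner x v w) :
    ∃ φ : M → ℝ, ContMDiff (𝓡 1) 𝓘(ℝ, ℝ) ∞ φ ∧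
      ∀ ψ : ℕ → M → ℝ, (∀ k, ContMDiff (𝓡 1) 𝓘(ℝ, ℝ) ∞ (ψ k)) →
        ¬ Filter.Tendsto (fun k => ∫⁻ x, ENNReal.ofReal (h₂.inner x
          (gradient h₁ φ x - gradient h₂ (ψ k) x) (gradient h₁ φ x - gradient h₂ (ψ k) x))
            ∂(riemannianVolume h₁)) Filter.atTop (𝓝 0) := by
  obtain ⟨p, i, hi⟩ := exists_fderiv_conformalFactor_sq_ne_zero hν hν_nonconst hconf
  obtain rfl : i = 0 := Subsingleton.elim _ _
  set e := chartAt (EuclideanSpace ℝ (Fin 1)) p with he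
  have hw := contDiffOn_conformalFactor_sq hconf p
  obtain ⟨R, hR, hball, hpos⟩ := exists_closedBall_pos p
    ((hw.continuousOn_fderiv_of_isOpen e.open_target (by simp)).clm_apply
      (continuousOn_const (c := line 1))) hi
  have hbump := exists_bump p hR hball
  obtain ⟨t₀, ht₀⟩ := line.surjective (e p)
  rw [← he, ← ht₀] at hbump hpos
  rw [← ht₀] at hball
  obtain ⟨φ, b, β, hφ, hbβ, hβR, hφb, hφ0⟩ := hbump
  refine ⟨φ, hφ, fun ψ hψ hlim => ?_⟩
  have hbR : b.rOut < R := by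
    rw [hbβ, ← hβR]
    exact β.rIn_lt_rOut
  obtain ⟨r, hbr, hrR⟩ := exists_between hbR
  have hb0 := b.rOut_pos
  have hballr : Metric.closedBall (line t₀) r ⊆ Metric.closedBall (line t₀) R :=
    Metric.closedBall_subset_closedBall hrR.le
  have hmem : ∀ t ∈ Icc (t₀ - R) (t₀ + R), line t ∈ e.target := fun t ht =>
    hball (line_image_Icc t₀ R ▸ ⟨t, ht, rfl⟩)
  have hlim' := fun q K hK hKt =>
    tendsto_setLIntegral_enorm_sub hconf hφ hψ hlim q (K := K) hK hKt (line 1)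
  have hLoc : LocallyConnectedSpace M :=
    ChartedSpace.locallyConnectedSpace (EuclideanSpace ℝ (Fin 1)) M
  have hJ : (realChart p).symm '' Icc (t₀ - b.rOut) (t₀ + b.rOut) =
      e.symm '' Metric.closedBall (line t₀) b.rOut := by
    rw [← line_image_Icc, image_image]
    rfl
  have htarget : ∀ t ∈ Icc (t₀ - R) (t₀ + R), t ∈ (realChart p).target := fun t ht =>
    mem_realChart_target.2 (hmem t ht)
  have hsubJ : Icc (t₀ - b.rOut) (t₀ + b.rOut) ⊆ (realChart p).target := fun t ht =>
    htarget t ⟨by linarith [ht.1], by linarith [ht.2]⟩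
  -- `φ` vanishes off the arc of radius `b.rOut`; the points at distance `r` are in the complement
  have hconn := isPreconnected_compl_arc (fun x : M => ⟨realChart x, mem_realChart_source x⟩)
    (realChart p) (a' := t₀ - R) (a := t₀ - b.rOut) (b := t₀ + b.rOut) (b' := t₀ + R)
    (by linarith) (by linarith) (by linarith) fun t ht => htarget t (Ioo_subset_Icc_self ht)
  have hopen := (isClosed_symm_image_Icc hsubJ).isOpen_compl
  have hout : ∀ t ∈ Icc (t₀ - R) (t₀ + R), t ∉ Icc (t₀ - b.rOut) (t₀ + b.rOut) →
      e.symm (line t) ∈ ((realChart p).symm '' Icc (t₀ - b.rOut) (t₀ + b.rOut))ᶜ :=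
    fun t ht hn h => hn ((symm_mem_symm_image hsubJ (htarget t ht)).1 h)
  have hzero := tendsto_sub_of_isPreconnected (w := fun x => ν x ^ 2) hopen hconn
    (fun x hx => hφ0 x (hJ ▸ hx)) hφ hψ
    (fun q => (contDiffOn_conformalFactor_sq hconf q).continuousOn) hlim'
    (hout (t₀ - r) ⟨by linarith, by linarith⟩ fun h => by linarith [h.1])
    (hout (t₀ + r) ⟨by linarith, by linarith⟩ fun h => by linarith [h.2])
  -- the increment across the arc
  have hst : line '' uIcc (t₀ - r) (t₀ + r) ⊆ e.target := by
    rw [uIcc_of_le (by linarith), line_image_Icc]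
    exact hballr.trans hball
  have hjump := tendsto_sub_of_tendsto_lintegral e.open_target hw.continuousOn
    (contDiffOn_comp_chart_symm hφ p) (fun k => contDiffOn_comp_chart_symm (hψ k) p) hst
    (hlim' p _ (isCompact_uIcc.image line.continuous) hst)
  have hval := tendsto_nhds_unique hjump hzero
  refine integral_mul_fderiv_bump_ne_zero e.open_target hw b hbr.le (hballr.trans hball)
    (fun y hy => hpos y (hballr hy)) ?_
  rw [← hval]
  refine intervalIntegral.integral_congr fun s hs => ?_
  have : φ ∘ e.symm =ᶠ[𝓝 (line s)] b :=
    hφb.eventuallyEq_of_mem (e.open_target.mem_nhds (hst ⟨s, hs, rfl⟩))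
  rw [← this.fderiv_eq]

end

section
variable {n : ℕ} {M : Type*} [TopologicalSpace M] [ChartedSpace (EuclideanSpace ℝ (Fin n)) M]
  [IsManifold (𝓡 n) ∞ M] [MeasurableSpace M] [BorelSpace M] [SecondCountableTopology M]
  [T2Space M] [CompactSpace M] [ConnectedSpace M]

theorem exists_not_tendsto {h₁ h₂ : SmoothMetric n M} {ν : M → ℝ}
    (hν : ∀ x, 0 < ν x) (hν_nonconst : ¬ ∃ c : ℝ, ∀ x, ν x = c)
    (hconf : ∀ (x : M) (v w : TangentSpace (𝓡 n) x), h₂.inner x v w = ν x ^ 2 * h₁.inner x v w) :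
    ∃ φ : M → ℝ, ContMDiff (𝓡 n) 𝓘(ℝ, ℝ) ∞ φ ∧
      ∀ ψ : ℕ → M → ℝ, (∀ k, ContMDiff (𝓡 n) 𝓘(ℝ, ℝ) ∞ (ψ k)) →
        ¬ Filter.Tendsto (fun k => ∫⁻ x, ENNReal.ofReal (h₂.inner x
          (gradient h₁ φ x - gradient h₂ (ψ k) x) (gradient h₁ φ x - gradient h₂ (ψ k) x))
            ∂(riemannianVolume h₁)) Filter.atTop (𝓝 0) := by
  rcases eq_or_ne n 1 with rfl | hn
  · exact exists_not_tendsto_of_one_dim hν hν_nonconst hconf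
  · exact exists_not_tendsto_of_ne_one hn hν hν_nonconst hconf

end

/-! ### The differential of the identity between the two Wasserstein spaces -/

section
variable {n : ℕ} {M : Type*} [TopologicalSpace M] [ChartedSpace (EuclideanSpace ℝ (Fin n)) M]
  [IsManifold (𝓡 n) ∞ M] [MeasurableSpace M] [BorelSpace M] [SecondCountableTopology M]
  [CompactSpace M]

/-- The gradient for the metric `h`, as a square integrable field for the metric `g`. -/
noncomputable def gradientField (h g : SmoothMetric n M) (μ : Measure M) [IsFiniteMeasure μ]
    {φ : M → ℝ} (hφ : ContMDiff (𝓡 n) 𝓘(ℝ, ℝ) ∞ φ) : L2Field g μ :=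
  (⟨gradient h φ, gradient_mem_sqIntegrableFields h g μ hφ⟩ : sqIntegrableFields g μ)

theorem toField_gradientField (h g : SmoothMetric n M) (μ : Measure M) [IsFiniteMeasure μ]
    {φ : M → ℝ} (hφ : ContMDiff (𝓡 n) 𝓘(ℝ, ℝ) ∞ φ) :
    (gradientField h g μ hφ).toField = gradient h φ :=
  rfl

theorem measure_pushforward_id [ConnectedSpace M] (h₁ h₂ : SmoothMetric n M)
    (μ : WassersteinSpace h₁) :
    (pushforward h₁ h₂ id measurable_id μ).measure = μ.measure :=
  Measure.map_id

/-- Mean square limits for the normalized volume are mean square limits for the volume. -/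
theorem tendsto_lintegral_riemannianVolume [ConnectedSpace M] {h : SmoothMetric n M}
    {g : ℕ → M → ℝ≥0∞}
    (hg : Filter.Tendsto (fun k => ∫⁻ x, g k x ∂(normalizedVolume h).measure)
      Filter.atTop (𝓝 0)) :
    Filter.Tendsto (fun k => ∫⁻ x, g k x ∂(riemannianVolume h)) Filter.atTop (𝓝 0) := by
  have := isFiniteMeasure_riemannianVolume h
  have htop : riemannianVolume h univ ≠ ⊤ := measure_ne_top _ _
  have h1 := ENNReal.Tendsto.const_mul hg (Or.inr htop)
  rw [mul_zero] at h1
  refine h1.congr fun k => ?_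
  change riemannianVolume h univ *
    ∫⁻ x, g k x ∂((riemannianVolume h univ)⁻¹ • riemannianVolume h) = _
  rw [lintegral_smul_measure, smul_eq_mul, ← mul_assoc,
    ENNReal.mul_inv_cancel (riemannianVolume_univ_ne_zero h) htop, one_mul]

end

end WassersteinTangent

theorem mainTheorem4 {n : ℕ} {M : Type*} [TopologicalSpace M]
    [ChartedSpace (EuclideanSpace ℝ (Fin n)) M] [IsManifold (𝓡 n) ∞ M]
    [T2Space M] [SecondCountableTopology M] [CompactSpace M] [ConnectedSpace M]
    [MeasurableSpace M] [BorelSpace M]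
    (h₁ h₂ : WassersteinTangent.SmoothMetric n M) (ν : M → ℝ) (hν : ∀ x, 0 < ν x)
    (hν_nonconst : ¬ ∃ c : ℝ, ∀ x, ν x = c)
    (hconf : ∀ (x : M) (v w : TangentSpace (𝓡 n) x),
      h₂.inner x v w = ν x ^ 2 * h₁.inner x v w) :
    ∃ μ : WassersteinTangent.WassersteinSpace h₁,
      μ.measure = (WassersteinTangent.riemannianVolume h₁ Set.univ)⁻¹ •
        WassersteinTangent.riemannianVolume h₁ ∧
      ∃ φ : M → ℝ, ContMDiff (𝓡 n) 𝓘(ℝ, ℝ) ∞ φ ∧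
        ∃ V : WassersteinTangent.L2 h₁ μ.measure,
          WassersteinTangent.IsClassOf V (WassersteinTangent.gradient h₁ φ) ∧
          V ∈ μ.tangentSpace ∧
          ∃ W : WassersteinTangent.L2 h₂
              (WassersteinTangent.pushforward h₁ h₂ id measurable_id μ).measure,
            WassersteinTangent.IsDifferentialAt h₂ id measurable_id μ V W ∧
            W ∉ (WassersteinTangent.pushforward h₁ h₂ id measurable_id μ).tangentSpace := by
  open WassersteinTangent in
  obtain ⟨φ, hφ, hnot⟩ := exists_not_tendsto hν hν_nonconst hconf
  set μ := normalizedVolume h₁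
  set μ' := pushforward h₁ h₂ id measurable_id μ
  have hmeas : μ'.measure = μ.measure := measure_pushforward_id h₁ h₂ μ
  set v := gradientField h₁ h₁ μ.measure hφ
  set w := gradientField h₁ h₂ μ'.measure hφ with hw
  have hclass : IsClassOf (SeparationQuotient.mk v : L2 h₁ μ.measure) (gradient h₁ φ) :=
    ⟨v, Filter.EventuallyEq.rfl, rfl⟩
  refine ⟨μ, rfl, φ, hφ, SeparationQuotient.mk v, hclass,
    subset_closure ⟨φ, hφ, HasCompactSupport.of_compactSpace φ, hclass⟩,
    SeparationQuotient.mk w, ⟨v, rfl, w, ?_, rfl⟩, fun hmem => ?_⟩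
  · change WassersteinTangent.gradient h₁ φ =ᵐ[μ'.measure]
      fibreAverage id μ.measure (WassersteinTangent.gradient h₁ φ)
    rw [hmeas]
    exact (fibreAverage_id μ.measure (gradient h₁ φ)).symm
  · obtain ⟨ψ, hψ, hlim⟩ := exists_seq_of_mem_tangentSpace μ' w hmem
    simp only [hw, toField_gradientField] at hlim
    rw [hmeas] at hlim
    exact hnot ψ hψ (tendsto_lintegral_riemannianVolume hlim)
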